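/- A biframe $L=(L_0,L_1,L_2)$ is a frame $L_0$ (the ambient frame) with two subframes $L_1,L_2$ (the components) that together generate $L_0$; a biframe homomorphism $L\to M$ is a frame homomorphism $L_0\to M_0$ mapping $L_i$ into $M_i$ for $i=1,2$. For an object $X$ of a category, $\mathcal S(X)$ is the posetal reflection of the class of extremal epimorphisms $f$ with domain $X$ preordered by $f\lesssim g$ iff $f=h\cdot g$ for some $h$; its elements $\langle f\rangle$ are called sublocales if $X$ is a frame and subbilocales if $X$ is a biframe. For an element $x$ of a frame, $\mathfrak c(x)$ and $\mathfrak o(x)$ are the closed and open sublocales determined by $x$; $1$ denotes the class of the identity and $0$ the class of the map onto the trivial (one-element) object. The congruence biframe of a biframe $L$ has as its first (second) component the subframe of the frame $\mathcal C(L_0)$ of congruences of $L_0$, ordered by inclusion, generated by the closed congruences $\{(u,v): u\vee x=v\vee x\}$ with $x\in L_1$ ($x\in L_2$) and the open congruences $\{(u,v): u\wedge y=v\wedge y\}$ with $y\in L_2$ ($y\in L_1$); its ambient frame $\mathcal C_0L_0$ is the subframe of $\mathcal C(L_0)$ generated by these two components. Let $\mathbf 3=\{0<a<1\}$, and let $\mathbf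 3.\mathbf 3$ be the biframe whose ambient frame is the coproduct $\mathbf 3\oplus\mathbf 3$ of frames and whose components are the (isomorphic) images of $\mathbf 3$ under the two coproduct injections. Put $a_1=a\oplus 1$ and $a_2=1\oplus a$. Then: 1. $\mathcal S(\mathbf 3)$ has exactly four elements $1,\mathfrak o(a),\mathfrak c(a),0$, with $\mathfrak o(a)$ and $\mathfrak c(a)$ incomparable. 2. $\mathbf 3\oplus\mathbf 3$ has exactly the six elements $0<a_1\wedge a_2=a\oplus a<a_1,a_2<a_1\vee a_2<1$, with $a_1,a_2$ incomparable. 3. $\langle f\rangle\mapsto\langle f_0\rangle$, where $f_0$ is the underlying frame homomorphism of $f$, is a well-defined order embedding $\mathcal S(\mathbf 3.\mathbf 3)\to\mathcal S(\mathbf 3\oplus\mathbf 3)$, whose image is the sub-$\wedge$-semilattice generated by $\{\mathfrak o(a_1),\mathfrak o(a_2),\mathfrak c(a_1),\mathfrak c(a_2),1,0\}$. Under this embedding, $\mathcal S(\mathbf 3.\mathbf 3)$ has exactly ten elements $$1,\quad \mathfrak c(a_1),\ \mathfrak c(a_2),\ \mathfrak o(a_2),\ \mathfrak o(a_1),\quad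 \mathfrak c(a_1\vee a_2),\ \mathfrak c(a_1)\wedge\mathfrak o(a_2),\ \mathfrak c(a_2)\wedge\mathfrak o(a_1),\ \mathfrak o(a\oplus a),\quad 0,$$ and its covering relations are exactly the following: $1$ covers $\mathfrak c(a_1),\mathfrak c(a_2),\mathfrak o(a_2),\mathfrak o(a_1)$; $\mathfrak c(a_1)$ covers $\mathfrak c(a_1\vee a_2)$ and $\mathfrak c(a_1)\wedge\mathfrak o(a_2)$; $\mathfrak c(a_2)$ covers $\mathfrak c(a_1\vee a_2)$ and $\mathfrak c(a_2)\wedge\mathfrak o(a_1)$; $\mathfrak o(a_2)$ covers $\mathfrak c(a_1)\wedge\mathfrak o(a_2)$ and $\mathfrak o(a\oplus a)$; $\mathfrak o(a_1)$ covers $\mathfrak c(a_2)\wedge\mathfrak o(a_1)$ and $\mathfrak o(a\oplus a)$; and each of $\mathfrak c(a_1\vee a_2)$, $\mathfrak c(a_1)\wedge\mathfrak o(a_2)$, $\mathfrak c(a_2)\wedge\mathfrak o(a_1)$, $\mathfrak o(a\oplus a)$ covers $0$. 4. The open congruence of $a_1\vee a_2$ belongs to $\mathcal C_0L_0$ for $L=\mathbf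 3.\mathbf 3$, but the open sublocale $\mathfrak o(a_1\vee a_2)$ is not in the image of $\mathcal S(\mathbf 3.\mathbf 3)$ in $\mathcal S(\mathbf 3\oplus\mathbf 3)$. 5. $\mathcal S(\mathbf 3.\mathbf 3)$ is a complete lattice containing the pentagon $N_5$ as a sublattice. It is not distributive, and hence is not a coframe. 6. For $L=\mathbf 3.\mathbf 3$, the lattice $\mathcal S(L)$ is not dually order-isomorphic to the ambient frame $\mathcal C_0L_0$ of the congruence biframe of $L$. In particular, for a biframe $L$, $\mathcal S(L)$ need not be distributive and is not in general dual to the ambient frame of the congruence biframe of $L$. -/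

import Mathlib

open CategoryTheory

universe u v

/-! ### Subobjects: classes of extremal epimorphisms -/

/-- An extremal epimorphism with domain `X`. -/
structure ExtremalQuotient {C : Type u} [Category.{v} C] (X : C) where
  obj : C
  hom : X ⟶ obj
  extremal : ExtremalEpi hom

/-- The preorder on extremal epimorphisms out of `X`: `f ≲ g` iff `f` factors through `g`. -/
instance {C : Type u} [Category.{v} C] (X : C) : Preorder (ExtremalQuotient X) where
  le f g := ∃ h : g.obj ⟶ f.obj, g.hom ≫ h = f.hom
  le_refl f := ⟨𝟙 _, Category.comp_id _⟩
  le_trans := by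
    rintro f g k ⟨h, hh⟩ ⟨h', hh'⟩
    exact ⟨h' ≫ h, by rw [← Category.assoc, hh', hh]⟩

/-- `𝒮(X)`: the posetal reflection of the preorder of extremal epimorphisms out of `X`. In the
category of frames these are the sublocales of `X`, in the category of biframes the
subbilocales of `X`. -/
abbrev SubPoset {C : Type u} [Category.{v} C] (X : C) : Type (max u v) :=
  Antisymmetrization (ExtremalQuotient X) (· ≤ ·)

/-- The class `⟨f⟩` of an extremal epimorphism. -/
abbrev SubPoset.mk {C : Type u} [Category.{v} C] {X : C} (f : ExtremalQuotient X) : SubPoset X :=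
  toAntisymmetrization (· ≤ ·) f

/-- The class of the identity. -/
def SubPoset.whole {C : Type u} [Category.{v} C] (X : C) : SubPoset X :=
  SubPoset.mk ⟨X, 𝟙 X, inferInstance⟩

/-! ### Frames: the three-element frame, closed and open sublocales -/

/-- The frame homomorphism `{0 < a < 1} → F` with `a ↦ x`. -/
def chainHom {F : Type u} [Order.Frame F] (x : F) : FrameHom (Fin 3) F where
  toFun := ![⊥, x, ⊤]
  map_inf' := by
    intro p q
    fin_cases p <;> fin_cases q <;> simp
  map_top' := rfl
  map_sSup' := by
    intro s
    have hm : Monotone (![⊥, x, ⊤] : Fin 3 → F) := by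
      intro p q h
      fin_cases p <;> fin_cases q <;> simp_all
    apply le_antisymm
    · rcases s.eq_empty_or_nonempty with rfl | hs
      · rw [sSup_empty]
        exact bot_le
      · exact le_sSup (Set.mem_image_of_mem _ (hs.csSup_mem s.toFinite))
    · apply sSup_le
      rintro _ ⟨p, hp, rfl⟩
      exact hm (le_sSup hp)

theorem frm_injective_of_mono {X Y : Frm.{0}} (m : X ⟶ Y) [Mono m] : Function.Injective m := by
  intro x y hxy
  have h : Frm.ofHom (chainHom x) ≫ m = Frm.ofHom (chainHom y) ≫ m := by
    ext p
    change m (![⊥, x, ⊤] p) = m (![⊥, y, ⊤] p)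
    fin_cases p
    · rfl
    · exact hxy
    · change m ⊤ = m ⊤
      rfl
  have h' := (cancel_mono m).1 h
  have := congrArg (fun k : Frm.of (Fin 3) ⟶ X => k (1 : Fin 3)) h'
  exact this

theorem frm_extremalEpi_of_surjective {X Y : Frm.{0}} (f : X ⟶ Y) (hf : Function.Surjective f) :
    ExtremalEpi f where
  left_cancellation g h e := by
    ext y
    obtain ⟨x, rfl⟩ := hf y
    exact congrArg (fun k : X ⟶ _ => k x) e
  isIso := by
    intro Z p m fac hm
    have hs : Function.Surjective m := by
      intro y
      obtain ⟨x, rfl⟩ := hf y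
      exact ⟨p x, congrArg (fun k : X ⟶ Y => k x) fac⟩
    have hi := frm_injective_of_mono m
    let e : Z ≃o Y :=
      { Equiv.ofBijective m ⟨hi, hs⟩ with
        map_rel_iff' := by
          intro a b
          change m a ≤ m b ↔ a ≤ b
          constructor
          · intro h
            apply inf_eq_left.1
            apply hi
            rw [map_inf, inf_eq_left.2 h]
          · intro h
            apply inf_eq_left.1
            rw [← map_inf, inf_eq_left.2 h] }
    have he : (Frm.Iso.mk e).hom = m := by
      ext z
      rfl
    rw [← he]
    infer_instance

/-- A sublocale set `S` of `F`, as the class of the quotient map `F → S`. -/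
def Sublocale.toSub {F : Type} [Order.Frame F] (S : Sublocale F) : SubPoset (Frm.of F) :=
  SubPoset.mk ⟨Frm.of S, Frm.ofHom S.restrict,
    frm_extremalEpi_of_surjective _ (fun s => ⟨s.1, Sublocale.restrict_of_mem s.2⟩)⟩

/-- The closed sublocale `𝔠(a)`, given by the quotient `x ↦ a ⊔ x` onto `↑a`. -/
def closedSub {F : Type} [Order.Frame F] (a : F) : SubPoset (Frm.of F) :=
  Nucleus.toSublocale (X := F)
    { toFun := fun x => a ⊔ x
      map_inf' := fun x y => sup_inf_left a x y
      idempotent' := fun x => by simp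
      le_apply' := fun x => le_sup_right } |>.toSub

/-- The open sublocale `𝔬(a)`, given by the quotient `x ↦ a ⇨ x` onto `{a ⇨ x | x}`. -/
def openSub {F : Type} [Order.Frame F] (a : F) : SubPoset (Frm.of F) :=
  Nucleus.toSublocale (X := F)
    { toFun := fun x => a ⇨ x
      map_inf' := fun x y => himp_inf_distrib a x y
      idempotent' := fun x => by simp
      le_apply' := fun x => le_himp } |>.toSub

/-- The class of the homomorphism onto the one-element frame. -/
def voidSub (F : Type) [Order.Frame F] : SubPoset (Frm.of F) :=
  SubPoset.mk ⟨Frm.of PUnit,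
    Frm.ofHom
      { toFun := fun _ => PUnit.unit
        map_inf' := fun _ _ => rfl
        map_top' := rfl
        map_sSup' := fun _ => rfl },
    frm_extremalEpi_of_surjective _ (fun _ => ⟨(⊥ : F), rfl⟩)⟩

/-! ### Biframes -/

/-- A subset closed under finite meets and arbitrary joins. -/
structure IsSubframe {F : Type u} [CompleteLattice F] (T : Set F) : Prop where
  top_mem : ⊤ ∈ T
  inf_mem : ∀ x ∈ T, ∀ y ∈ T, x ⊓ y ∈ T
  sSup_mem : ∀ A ⊆ T, sSup A ∈ T

/-- The subset generated by `A` under finite meets and arbitrary joins. -/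
def subframeClosure {F : Type u} [CompleteLattice F] (A : Set F) : Set F :=
  ⋂₀ {T | IsSubframe T ∧ A ⊆ T}

/-- Biframes `(L₀, L₁, L₂)`: an ambient frame with two subframes which together generate it. -/
structure BiFrm where
  ambient : Type u
  [frame : Order.Frame ambient]
  fst : Set ambient
  snd : Set ambient
  isSubframe_fst : IsSubframe fst
  isSubframe_snd : IsSubframe snd
  generates : subframeClosure (fst ∪ snd) = Set.univ

namespace BiFrm

attribute [instance] BiFrm.frame

/-- Biframe homomorphisms. -/
@[ext]
structure Hom (L M : BiFrm.{u}) where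
  toFrameHom : FrameHom L.ambient M.ambient
  map_fst : ∀ x ∈ L.fst, toFrameHom x ∈ M.fst
  map_snd : ∀ x ∈ L.snd, toFrameHom x ∈ M.snd

instance : Category BiFrm.{u} where
  Hom := Hom
  id L := ⟨FrameHom.id _, fun _ h => h, fun _ h => h⟩
  comp f g := ⟨g.toFrameHom.comp f.toFrameHom,
    fun x h => g.map_fst _ (f.map_fst x h), fun x h => g.map_snd _ (f.map_snd x h)⟩

/-- The functor sending a biframe to its ambient frame. -/
def ambientFunctor : BiFrm.{u} ⥤ Frm.{u} where
  obj L := Frm.of L.ambient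
  map f := Frm.ofHom f.toFrameHom

end BiFrm

/-! ### The congruence biframe -/

/-- Frame congruences: equivalence relations respecting finite meets and all joins. -/
structure FrameCongruence (F : Type u) [Order.Frame F] extends Setoid F where
  inf : ∀ {a b c d : F}, r a b → r c d → r (a ⊓ c) (b ⊓ d)
  iSup : ∀ {ι : Type u} (f g : ι → F), (∀ i, r (f i) (g i)) → r (⨆ i, f i) (⨆ i, g i)

namespace FrameCongruence

variable {F : Type u} [Order.Frame F]

/-- Frame congruences are ordered by inclusion. -/
instance : PartialOrder (FrameCongruence F) :=
  PartialOrder.lift FrameCongruence.toSetoid (by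
    rintro ⟨s, _, _⟩ ⟨t, _, _⟩ h
    cases h
    rfl)

/-- Infima are intersections. -/
instance : InfSet (FrameCongruence F) where
  sInf A :=
    { r := fun x y => ∀ θ ∈ A, θ.r x y
      iseqv := ⟨fun x θ _ => θ.iseqv.refl x, fun h θ hθ => θ.iseqv.symm (h θ hθ),
        fun h h' θ hθ => θ.iseqv.trans (h θ hθ) (h' θ hθ)⟩
      inf := fun h h' θ hθ => θ.inf (h θ hθ) (h' θ hθ)
      iSup := fun f g h θ hθ => θ.iSup f g (fun i => h i θ hθ) }

instance : CompleteLattice (FrameCongruence F) :=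
  completeLatticeOfInf _ (fun _ =>
    ⟨fun θ hθ _ _ h => h θ hθ, fun _ hψ _ _ h _ hθ => hψ hθ h⟩)

/-- The closed congruence of `a`. -/
def closedCong (a : F) : FrameCongruence F where
  r x y := x ⊔ a = y ⊔ a
  iseqv := ⟨fun _ => rfl, fun h => h.symm, fun h h' => h.trans h'⟩
  inf h h' := by rw [sup_inf_right, sup_inf_right, h, h']
  iSup {ι} f g h := by
    rcases isEmpty_or_nonempty ι with _ | _
    · simp [iSup_of_empty]
    · simp only [iSup_sup, h]

/-- The open congruence of `a`. -/
def openCong (a : F) : FrameCongruence F where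
  r x y := x ⊓ a = y ⊓ a
  iseqv := ⟨fun _ => rfl, fun h => h.symm, fun h h' => h.trans h'⟩
  inf h h' := by rw [inf_inf_distrib_right _ _ a, h, h', ← inf_inf_distrib_right _ _ a]
  iSup f g h := by simp only [iSup_inf_eq, h]

end FrameCongruence

namespace BiFrm

/-- The first component of the congruence biframe of `L`: the subframe of the frame of congruences
of `L₀` generated by the closed congruences of `L₁` and the open congruences of `L₂`. -/
def congruenceFst (L : BiFrm.{u}) : Set (FrameCongruence L.ambient) :=
  subframeClosure (FrameCongruence.closedCong '' L.fst ∪ FrameCongruence.openCong '' L.snd)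

/-- The second component of the congruence biframe of `L`. -/
def congruenceSnd (L : BiFrm.{u}) : Set (FrameCongruence L.ambient) :=
  subframeClosure (FrameCongruence.closedCong '' L.snd ∪ FrameCongruence.openCong '' L.fst)

/-- The ambient frame of the congruence biframe of `L`, with the order of inclusion. -/
def congruenceAmbient (L : BiFrm.{u}) : Set (FrameCongruence L.ambient) :=
  subframeClosure (L.congruenceFst ∪ L.congruenceSnd)

end BiFrm

/-! ### The biframe `𝟑.𝟑` -/

/-- The frame `𝟑 ⊕ 𝟑`, realized as the six-element frame of lower sets of the four-element
Boolean algebra; `inclLeft` and `inclRight` are the coproduct injections. -/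
abbrev ThreeSumThree : Type := LowerSet (Bool × Bool)

/-- The first injection `x ↦ x ⊕ 1`. -/
def inclLeft : FrameHom (Fin 3) ThreeSumThree := chainHom (LowerSet.Iic (false, true))

/-- The second injection `y ↦ 1 ⊕ y`. -/
def inclRight : FrameHom (Fin 3) ThreeSumThree := chainHom (LowerSet.Iic (true, false))

theorem isSubframe_range {F G : Type u} [Order.Frame F] [Order.Frame G] (f : FrameHom F G) :
    IsSubframe (Set.range f) where
  top_mem := ⟨⊤, map_top f⟩
  inf_mem := by
    rintro _ ⟨x, rfl⟩ _ ⟨y, rfl⟩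
    exact ⟨x ⊓ y, map_inf f x y⟩
  sSup_mem := by
    intro A hA
    refine ⟨sSup (f ⁻¹' A), ?_⟩
    rw [map_sSup, Set.image_preimage_eq_of_subset hA]

/-- The biframe `𝟑.𝟑`: the ambient frame is `𝟑 ⊕ 𝟑`, the components are the images of the two
coproduct injections. -/
def threeThree : BiFrm.{0} where
  ambient := ThreeSumThree
  fst := Set.range inclLeft
  snd := Set.range inclRight
  isSubframe_fst := isSubframe_range _
  isSubframe_snd := isSubframe_range _
  generates := by
    apply Set.eq_univ_of_forall
    rintro U T ⟨hT, hA⟩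
    have hL : ∀ b : Bool, LowerSet.Iic (b, true) ∈ T := by
      intro b
      cases b
      · exact hA (Or.inl ⟨1, rfl⟩)
      · have : (LowerSet.Iic ((true, true) : Bool × Bool)) = ⊤ := LowerSet.Iic_top
        rw [this]
        exact hT.top_mem
    have hR : ∀ b : Bool, LowerSet.Iic (true, b) ∈ T := by
      intro b
      cases b
      · exact hA (Or.inr ⟨1, rfl⟩)
      · exact hL true
    have hP : ∀ p : Bool × Bool, LowerSet.Iic p ∈ T := by
      rintro ⟨b, c⟩
      have := hT.inf_mem _ (hL b) _ (hR c)
      rw [← LowerSet.Iic_inf] at this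
      simpa using this
    have hU : U = sSup {V | ∃ p ∈ U, V = LowerSet.Iic p} := by
      apply le_antisymm
      · intro p hp
        exact LowerSet.mem_sSup_iff.2 ⟨_, ⟨p, hp, rfl⟩, le_refl p⟩
      · apply sSup_le
        rintro _ ⟨p, hp, rfl⟩
        exact LowerSet.Iic_le.2 hp
    rw [hU]
    apply hT.sSup_mem
    rintro _ ⟨p, _, rfl⟩
    exact hP p

/-- The elements of the Hasse diagram of `𝒮(𝟑.𝟑)`. -/
inductive Node
  /-- the whole biframe `𝟑.𝟑` -/
  | whole
  /-- `𝔠(a ⊕ 1)` -/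
  | c₁
  /-- `𝔠(1 ⊕ a)` -/
  | c₂
  /-- `𝔬(1 ⊕ a)` -/
  | o₂
  /-- `𝔬(a ⊕ 1)` -/
  | o₁
  /-- `𝔠(a ⊕ 1 ∨ 1 ⊕ a)` -/
  | c₁c₂
  /-- `𝔠(a ⊕ 1) ∧ 𝔬(1 ⊕ a)` -/
  | c₁o₂
  /-- `𝔠(1 ⊕ a) ∧ 𝔬(a ⊕ 1)` -/
  | c₂o₁
  /-- `𝔬(a ⊕ a)` -/
  | o₁o₂
  /-- the trivial biframe `𝟏.𝟏` -/
  | void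

/-- The sixteen edges of the Hasse diagram of `𝒮(𝟑.𝟑)`: `Edge p q` says that `q` covers `p`. -/
inductive Edge : Node → Node → Prop
  | c₁_whole : Edge .c₁ .whole
  | c₂_whole : Edge .c₂ .whole
  | o₂_whole : Edge .o₂ .whole
  | o₁_whole : Edge .o₁ .whole
  | c₁c₂_c₁ : Edge .c₁c₂ .c₁
  | c₁o₂_c₁ : Edge .c₁o₂ .c₁
  | c₁c₂_c₂ : Edge .c₁c₂ .c₂
  | c₂o₁_c₂ : Edge .c₂o₁ .c₂
  | c₁o₂_o₂ : Edge .c₁o₂ .o₂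
  | o₁o₂_o₂ : Edge .o₁o₂ .o₂
  | c₂o₁_o₁ : Edge .c₂o₁ .o₁
  | o₁o₂_o₁ : Edge .o₁o₂ .o₁
  | void_c₁c₂ : Edge .void .c₁c₂
  | void_c₁o₂ : Edge .void .c₁o₂
  | void_c₂o₁ : Edge .void .c₂o₁
  | void_o₁o₂ : Edge .void .o₁o₂

/-- `P` contains a copy of the pentagon `N₅` (bottom `o`, chain `x < z`, side `y`, top `i`) whose
meets and joins are those of `P`. -/
def ContainsPentagon (P : Type u) [PartialOrder P] : Prop :=
  ∃ o x z y i : P, x < z ∧ IsGLB {x, y} o ∧ IsGLB {z, y} o ∧ IsLUB {x, y} i ∧ IsLUB {z, y} i ∧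
    [o, x, z, y, i].Nodup

/-! Everything is reduced to subsets of a four-point set. The frame `𝟑` is free on one generator, so
`𝟑 ⊕ 𝟑` is free on two: it is the frame of lower sets of `Bool × Bool`, the free meet-semilattice
with top on two generators. For a well-founded poset `P`, a congruence on `LowerSet P` is determined
by the set of points `p` at which it does not identify `Iic p` with `Iio p`: two lower sets are
congruent exactly when they agree on that set (`FrameCongruence.rel_iff_points`), and every set of
points occurs. Extremal epimorphisms of frames are the surjections, ordered by reverse inclusion of
kernels. Hence sublocales of `𝟑 ⊕ 𝟑` correspond to the subsets of `Bool × Bool` (`pointSub`), open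
ones to lower sets and closed ones to their complements, while congruences correspond to the same
subsets in the reverse order (`pointCongIso`).

For biframes the decisive fact is that a homomorphism is monic exactly when it is injective on each
component (`mono_of_injOn`, `injOn_fst_of_mono`, `injOn_snd_of_mono`); injectivity on the ambient
frame is not needed. A component of `𝟑.𝟑` sees only one coordinate of a point, so the quotient given
by `S` factors through the one given by the product of the two projections of `S`, followed by a
monomorphism. Extremality therefore forces `S` to be that product, and conversely the quotient given
by a rectangle is extremal (`extremalEpi_pointBiframeHom`, `exists_isIso_of_extremalEpi`). So
`𝒮(𝟑.𝟑)` is the poset of the ten rectangles.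

The rest is finite. Rectangles are closed under intersection, which gives completeness and the
generated meet-semilattice, but not under union: the join of two opposite corners is the whole
square, which produces the pentagon. The set of `a₁ ∨ a₂` is the square minus a corner and is not a
rectangle. All congruences of `𝟑 ⊕ 𝟑` lie in the ambient frame of the congruence biframe, so that
frame is distributive and cannot be dual to `𝒮(𝟑.𝟑)`. -/

/-! ### Factorizations of frame homomorphisms -/

section FrameHom

variable {F G H : Type u} [Order.Frame F] [Order.Frame G] [Order.Frame H]

/-- The homomorphism induced on the codomain of a surjective `g` by a homomorphism `f` whose kernel
contains that of `g`. -/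
noncomputable def FrameHom.descend (g : FrameHom F G) (hg : Function.Surjective g)
    (f : FrameHom F H) (h : ∀ x y, g x = g y → f x = f y) : FrameHom G H where
  toFun y := f (Function.surjInv hg y)
  map_inf' a b := by
    rw [← map_inf]
    apply h
    simp only [map_inf, Function.surjInv_eq]
  map_top' := by
    rw [← map_top f]
    apply h
    simp only [map_top, Function.surjInv_eq]
  map_sSup' s := by
    have : f (Function.surjInv hg (sSup s)) = f (sSup (Function.surjInv hg '' s)) := by
      apply h
      rw [map_sSup, Set.image_image]
      simp only [Function.surjInv_eq, Set.image_id']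
    rw [this, map_sSup, Set.image_image]

theorem FrameHom.descend_apply (g : FrameHom F G) (hg : Function.Surjective g)
    (f : FrameHom F H) (h : ∀ x y, g x = g y → f x = f y) (x : F) :
    g.descend hg f h (g x) = f x :=
  h _ _ (Function.surjInv_eq hg (g x))

/-- The nucleus of a frame homomorphism: `x` is sent to the largest element with the same image. -/
def FrameHom.kerNucleus (f : FrameHom F G) : Nucleus F where
  toFun x := sSup {y | f y ≤ f x}
  map_inf' x y := by
    -- Since `f` preserves joins, the supremum itself satisfies the defining inequality;
    -- preservation of meets then follows by comparing lower bounds.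
    have key : ∀ z w, z ≤ sSup {y | f y ≤ f w} ↔ f z ≤ f w := fun z w => by
      refine ⟨fun h => (OrderHomClass.mono f h).trans ?_, fun h => le_sSup h⟩
      rw [map_sSup]
      exact sSup_le (by rintro _ ⟨_, h, rfl⟩; exact h)
    refine eq_of_forall_le_iff fun z => ?_
    rw [le_inf_iff, key, key, key, map_inf, le_inf_iff]
  idempotent' x := by
    refine sSup_le_sSup fun y (hy : f y ≤ _) => hy.trans ?_
    rw [map_sSup]
    exact sSup_le (by rintro _ ⟨_, h, rfl⟩; exact h)
  le_apply' x := le_sSup (le_refl (f x))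

theorem FrameHom.kerNucleus_eq_iff (f : FrameHom F G) (x y : F) :
    f.kerNucleus x = f.kerNucleus y ↔ f x = f y := by
  have key : ∀ z w, z ≤ f.kerNucleus w → f z ≤ f w := fun z w h => by
    refine (OrderHomClass.mono f h).trans ?_
    change f (sSup {y | f y ≤ f w}) ≤ _
    rw [map_sSup]
    exact sSup_le (by rintro _ ⟨_, h, rfl⟩; exact h)
  constructor
  · intro h
    exact le_antisymm (key _ _ (h ▸ Nucleus.le_apply)) (key _ _ (h.symm ▸ Nucleus.le_apply))
  · intro h
    change sSup {z | f z ≤ f x} = sSup {z | f z ≤ f y}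
    rw [h]

theorem Nucleus.restrict_toSublocale_eq_iff (n : Nucleus F) (x y : F) :
    n.toSublocale.restrict x = n.toSublocale.restrict y ↔ n x = n y := by
  rw [Nucleus.restrict_toSublocale, Nucleus.restrict_toSublocale]
  exact Subtype.ext_iff

theorem Sublocale.restrict_surjective (S : Sublocale F) : Function.Surjective S.restrict :=
  fun s => ⟨s.1, Sublocale.restrict_of_mem s.2⟩

end FrameHom

/-! ### Extremal epimorphisms of frames -/

/-- Factor `f` through the sublocale of its kernel nucleus. The second factor is injective, hence
monic, hence an isomorphism by extremality, while the first factor is onto. -/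
theorem frm_surjective_of_extremalEpi {X Y : Frm.{0}} (f : X ⟶ Y) (hf : ExtremalEpi f) :
    Function.Surjective f := by
  let n := f.hom.kerNucleus
  have hk : ∀ x y, n.toSublocale.restrict x = n.toSublocale.restrict y ↔ f x = f y := fun x y => by
    rw [Nucleus.restrict_toSublocale_eq_iff, FrameHom.kerNucleus_eq_iff]
  have hs := n.toSublocale.restrict_surjective
  let m : FrameHom n.toSublocale Y :=
    n.toSublocale.restrict.descend hs f.hom fun x y => (hk x y).1
  have hm : ∀ x, m (n.toSublocale.restrict x) = f x := FrameHom.descend_apply _ hs _ _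
  have hinj : Function.Injective m := by
    intro a b hab
    obtain ⟨x, rfl⟩ := hs a
    obtain ⟨y, rfl⟩ := hs b
    rw [hm, hm] at hab
    exact (hk x y).2 hab
  have : Mono (Frm.ofHom m) := ConcreteCategory.mono_of_injective _ hinj
  have := hf.isIso (Frm.ofHom n.toSublocale.restrict) (Frm.ofHom m) (by ext x; exact hm x)
  intro y
  obtain ⟨x, hx⟩ := hs (inv (Frm.ofHom m) y)
  refine ⟨x, ?_⟩
  rw [← hm, hx]
  exact congrArg (fun k : Y ⟶ Y => k y) (IsIso.inv_hom_id (Frm.ofHom m))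

/-- As extremal epimorphisms are onto, a factorization through `g` exists as soon as the kernels
allow it. Sublocales are thereby compared through their kernels alone. -/
theorem extremalQuotient_le_iff {X : Frm.{0}} (f g : ExtremalQuotient X) :
    f ≤ g ↔ ∀ x y, g.hom x = g.hom y → f.hom x = f.hom y := by
  constructor
  · rintro ⟨h, hh⟩ x y hxy
    rw [← hh]
    exact congrArg h hxy
  · intro h
    have hs := frm_surjective_of_extremalEpi g.hom g.extremal
    refine ⟨Frm.ofHom (g.hom.hom.descend hs f.hom.hom h), ?_⟩
    ext x
    exact FrameHom.descend_apply g.hom.hom hs f.hom.hom h x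

theorem SubPoset.mk_le_mk {C : Type u} [Category.{v} C] {X : C} {f g : ExtremalQuotient X} :
    SubPoset.mk f ≤ SubPoset.mk g ↔ f ≤ g :=
  Iff.rfl

theorem SubPoset.mk_le_mk_iff_ker {X : Frm.{0}} (f g : ExtremalQuotient X) :
    SubPoset.mk f ≤ SubPoset.mk g ↔ ∀ x y, g.hom x = g.hom y → f.hom x = f.hom y :=
  extremalQuotient_le_iff f g

theorem SubPoset.mk_eq_mk_iff_ker {X : Frm.{0}} (f g : ExtremalQuotient X) :
    SubPoset.mk f = SubPoset.mk g ↔ ∀ x y, f.hom x = f.hom y ↔ g.hom x = g.hom y := by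
  rw [le_antisymm_iff, mk_le_mk_iff_ker, mk_le_mk_iff_ker]
  exact ⟨fun h x y => ⟨h.2 x y, h.1 x y⟩, fun h => ⟨fun x y => (h x y).2, fun x y => (h x y).1⟩⟩

/-- The quotient map of a representative of the open sublocale of `a`. -/
theorem exists_openSub_eq_mk {F : Type} [Order.Frame F] (a : F) :
    ∃ Q : ExtremalQuotient (Frm.of F), openSub a = SubPoset.mk Q ∧
      ∀ x y : F, Q.hom x = Q.hom y ↔ x ⊓ a = y ⊓ a := by
  refine ⟨_, rfl, fun x y => ?_⟩
  refine (Nucleus.restrict_toSublocale_eq_iff _ x y).trans ?_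
  change a ⇨ x = a ⇨ y ↔ _
  constructor
  · intro h
    rw [← himp_inf_self, h, himp_inf_self]
  · intro h
    refine eq_of_forall_le_iff fun z => ?_
    have hx : ∀ w, z ≤ a ⇨ w ↔ z ⊓ a ≤ w ⊓ a := fun w => by simp
    rw [hx, hx, h]

theorem exists_closedSub_eq_mk {F : Type} [Order.Frame F] (a : F) :
    ∃ Q : ExtremalQuotient (Frm.of F), closedSub a = SubPoset.mk Q ∧
      ∀ x y : F, Q.hom x = Q.hom y ↔ a ⊔ x = a ⊔ y :=
  ⟨_, rfl, fun x y => Nucleus.restrict_toSublocale_eq_iff _ x y⟩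

theorem exists_voidSub_eq_mk (F : Type) [Order.Frame F] :
    ∃ Q : ExtremalQuotient (Frm.of F), voidSub F = SubPoset.mk Q ∧
      ∀ x y : F, Q.hom x = Q.hom y :=
  ⟨_, rfl, fun _ _ => rfl⟩

theorem exists_whole_eq_mk (F : Type) [Order.Frame F] :
    ∃ Q : ExtremalQuotient (Frm.of F), SubPoset.whole (Frm.of F) = SubPoset.mk Q ∧
      ∀ x y : F, Q.hom x = Q.hom y ↔ x = y :=
  ⟨_, rfl, fun _ _ => Iff.rfl⟩

/-! ### Sublocales of the three-element frame -/

/-- The kernel depends only on whether the middle element goes to `⊥` and whether it goes to `⊤`;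
both happen exactly when the codomain is trivial. -/
theorem chain_ker_iff {G : Type} [Order.Frame G] (f : FrameHom (Fin 3) G) (x y : Fin 3) :
    f x = f y ↔ x = y ∨ (f 1 = ⊥ ∧ f 1 = ⊤) ∨ (f 1 = ⊥ ∧ x ≠ 2 ∧ y ≠ 2) ∨
      (f 1 = ⊤ ∧ x ≠ 0 ∧ y ≠ 0) := by
  have h0 : f 0 = ⊥ := map_bot f
  have h2 : f 2 = ⊤ := map_top f
  have hbt : (⊥ : G) = ⊤ → f 1 = ⊥ ∧ f 1 = ⊤ := fun h =>
    ⟨le_bot_iff.1 (h ▸ le_top), top_le_iff.1 (h ▸ bot_le)⟩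
  have hbt' : (⊤ : G) = ⊥ → f 1 = ⊥ ∧ f 1 = ⊤ := fun h => hbt h.symm
  fin_cases x <;> fin_cases y <;> simp [h0, h2] <;> grind

theorem exists_chain_subPoset_iso :
    ∃ Ψ : Bool × Bool ≃o SubPoset (Frm.of (Fin 3)),
      Ψ (true, true) = SubPoset.whole (Frm.of (Fin 3)) ∧
      Ψ (true, false) = openSub (1 : Fin 3) ∧
      Ψ (false, true) = closedSub (1 : Fin 3) ∧
      Ψ (false, false) = voidSub (Fin 3) := by
  obtain ⟨w, hw, kw⟩ := exists_whole_eq_mk (Fin 3)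
  obtain ⟨o, ho, ko⟩ := exists_openSub_eq_mk (1 : Fin 3)
  obtain ⟨c, hc, kc⟩ := exists_closedSub_eq_mk (1 : Fin 3)
  obtain ⟨z, hz, kz⟩ := exists_voidSub_eq_mk (Fin 3)
  rw [hw, ho, hc, hz]
  let q : Bool × Bool → ExtremalQuotient (Frm.of (Fin 3)) := fun p =>
    match p with
    | (true, true) => w
    | (true, false) => o
    | (false, true) => c
    | (false, false) => z
  have hq : ∀ (p : Bool × Bool) (x y : Fin 3), (q p).hom x = (q p).hom y ↔
      x = y ∨ (p.1 = false ∧ p.2 = false) ∨ (p.1 = false ∧ x ≠ 2 ∧ y ≠ 2) ∨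
        (p.2 = false ∧ x ≠ 0 ∧ y ≠ 0) := by
    rintro ⟨_ | _, _ | _⟩ x y
    · simpa [q] using kz x y
    · simp only [q, kc]; revert x y; decide
    · simp only [q, ko]; revert x y; decide
    · simp [q, kw]
  have hle : ∀ p p', SubPoset.mk (q p) ≤ SubPoset.mk (q p') ↔ p ≤ p' := by
    intro p p'
    rw [SubPoset.mk_le_mk_iff_ker]
    change (∀ x y : Fin 3, (q p').hom x = (q p').hom y → (q p).hom x = (q p).hom y) ↔ _
    simp only [hq]
    revert p p'
    decide
  refine ⟨RelIso.ofSurjective (OrderEmbedding.ofMapLEIff (fun p => SubPoset.mk (q p)) hle) ?_,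
    rfl, rfl, rfl, rfl⟩
  intro s
  induction s using Quotient.inductionOn with | _ Q
  classical
  -- The two bits record whether `a` stays different from `⊥` and from `⊤` in the quotient.
  refine ⟨(decide (Q.hom (1 : Fin 3) ≠ ⊥), decide (Q.hom (1 : Fin 3) ≠ ⊤)), ?_⟩
  refine (SubPoset.mk_eq_mk_iff_ker _ Q).2 fun x y => ?_
  refine (hq _ x y).trans (Iff.trans ?_ (chain_ker_iff Q.hom.hom x y).symm)
  simp

/-! ### Congruences on frames of lower sets -/

section Points

variable {P : Type u} [PartialOrder P]

theorem FrameCongruence.le_iff {F : Type u} [Order.Frame F] {θ ψ : FrameCongruence F} :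
    θ ≤ ψ ↔ ∀ x y, θ.r x y → ψ.r x y :=
  ⟨fun h _ _ hxy => h hxy, fun h _ _ hxy => h _ _ hxy⟩

/-- The kernel congruence of a frame homomorphism. -/
def FrameHom.ker {F G : Type u} [Order.Frame F] [Order.Frame G] (f : FrameHom F G) :
    FrameCongruence F where
  r x y := f x = f y
  iseqv := ⟨fun _ => rfl, fun h => h.symm, fun h h' => h.trans h'⟩
  inf h h' := by rw [map_inf, map_inf, h, h']
  iSup g h e := by simp only [map_iSup, e]

/-- The congruence identifying two lower sets when they agree on the set `S` of points. -/
def pointCong (S : Set P) : FrameCongruence (LowerSet P) where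
  r U V := ∀ p ∈ S, p ∈ U ↔ p ∈ V
  iseqv := ⟨fun _ _ _ => Iff.rfl, fun h p hp => (h p hp).symm,
    fun h h' p hp => (h p hp).trans (h' p hp)⟩
  inf h h' p hp := by simp only [LowerSet.mem_inf_iff, h p hp, h' p hp]
  iSup f g h p hp := by simp only [LowerSet.mem_iSup_iff, h _ p hp]

/-- The points which are not collapsed by a congruence. -/
def FrameCongruence.points (θ : FrameCongruence (LowerSet P)) : Set P :=
  {p | ¬ θ.r (LowerSet.Iic p) (LowerSet.Iio p)}

theorem LowerSet.iSup_mem_Iic (U : LowerSet P) : ⨆ p : P, ⨆ _ : p ∈ U, LowerSet.Iic p = U := by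
  apply le_antisymm
  · exact iSup₂_le fun p hp => LowerSet.Iic_le.2 hp
  · intro p hp
    exact LowerSet.mem_iSup₂_iff.2 ⟨p, hp, le_refl p⟩

theorem FrameCongruence.rel_sup {F : Type u} [Order.Frame F] (θ : FrameCongruence F)
    {a b c d : F} (h : θ.r a b) (h' : θ.r c d) : θ.r (a ⊔ c) (b ⊔ d) := by
  -- Congruences respect joins over index types in the universe of the frame, so the two-element
  -- index has to be lifted.
  have := θ.iSup (fun i : ULift Bool => if i.down then a else c)
    (fun i : ULift Bool => if i.down then b else d) (by rintro ⟨_ | _⟩ <;> simpa)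
  have key : ∀ x y : F, ⨆ i : ULift Bool, (if i.down then x else y) = x ⊔ y := fun x y => by
    rw [← Equiv.ulift.symm.iSup_comp, iSup_bool_eq]
    rfl
  rwa [key, key] at this

/-- If `p` lay in `U` but not in `V`, meeting with `Iic p` and then joining with `Iio p` would turn
the pair `U`, `V` into `Iic p`, `Iio p`, which are not identified at an uncollapsed point. -/
theorem FrameCongruence.mem_of_rel (θ : FrameCongruence (LowerSet P)) {U V : LowerSet P}
    (h : θ.r U V) {p : P} (hp : p ∈ θ.points) (hU : p ∈ U) : p ∈ V := by
  by_contra hV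
  apply hp
  have h1 : LowerSet.Iic p ⊓ U ⊔ LowerSet.Iio p = LowerSet.Iic p := by
    rw [inf_eq_left.2 (LowerSet.Iic_le.2 hU)]
    exact sup_eq_left.2 fun q hq => le_of_lt hq
  have h2 : LowerSet.Iic p ⊓ V ⊔ LowerSet.Iio p = LowerSet.Iio p := by
    refine sup_eq_right.2 fun q hq => lt_of_le_of_ne hq.1 ?_
    rintro rfl
    exact hV hq.2
  have := θ.rel_sup (θ.inf (θ.iseqv.refl (LowerSet.Iic p)) h) (θ.iseqv.refl (LowerSet.Iio p))
  rwa [h1, h2] at this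

/-- By well-founded induction each `Iic p` with `p ∈ U` is congruent to `Iic p ⊓ W`: if `p ∉ W`,
then `p` is collapsed, so `Iic p` may be replaced by `Iio p`, a join of smaller principal lower
sets. Joining over all `p ∈ U` gives the claim. -/
theorem FrameCongruence.rel_inf_of_points [WellFoundedLT P] (θ : FrameCongruence (LowerSet P))
    {U W : LowerSet P} (h : ∀ p ∈ θ.points, p ∈ U → p ∈ W) : θ.r U (U ⊓ W) := by
  have key : ∀ p : P, p ∈ U → θ.r (LowerSet.Iic p) (LowerSet.Iic p ⊓ W) := by
    intro p
    induction p using WellFoundedLT.induction with | _ p ih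
    intro hp
    by_cases hW : p ∈ W
    · rw [inf_eq_left.2 (LowerSet.Iic_le.2 hW)]
    · have hpS : θ.r (LowerSet.Iic p) (LowerSet.Iio p) := by
        by_contra hn
        exact hW (h p hn hp)
      refine θ.iseqv.trans hpS ?_
      have hI : LowerSet.Iic p ⊓ W = LowerSet.Iio p ⊓ W := by
        ext q
        constructor
        · rintro ⟨hq, hqW⟩
          refine ⟨lt_of_le_of_ne hq ?_, hqW⟩
          rintro rfl
          exact hW hqW
        · rintro ⟨hq, hqW⟩
          exact ⟨le_of_lt hq, hqW⟩
      rw [hI]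
      have := θ.iSup (fun q : LowerSet.Iio p => LowerSet.Iic q.1)
        (fun q => LowerSet.Iic q.1 ⊓ W) fun q => ih q.1 q.2 (U.lower (le_of_lt q.2) hp)
      rw [← iSup_inf_eq] at this
      have e : ⨆ q : LowerSet.Iio p, LowerSet.Iic q.1 = LowerSet.Iio p := by
        rw [iSup_subtype]
        exact LowerSet.iSup_mem_Iic _
      rwa [e] at this
  have := θ.iSup (fun q : U => LowerSet.Iic q.1) (fun q => LowerSet.Iic q.1 ⊓ W)
    fun q => key q.1 q.2
  rw [← iSup_inf_eq] at this
  have e : ⨆ q : U, LowerSet.Iic q.1 = U := by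
    rw [iSup_subtype]
    exact LowerSet.iSup_mem_Iic _
  rwa [e] at this

theorem FrameCongruence.rel_iff_points [WellFoundedLT P] (θ : FrameCongruence (LowerSet P))
    (U V : LowerSet P) : θ.r U V ↔ ∀ p ∈ θ.points, p ∈ U ↔ p ∈ V := by
  constructor
  · intro h p hp
    exact ⟨θ.mem_of_rel h hp, θ.mem_of_rel (θ.iseqv.symm h) hp⟩
  · intro h
    have h1 := θ.rel_inf_of_points fun p hp => (h p hp).1
    have h2 := θ.rel_inf_of_points fun p hp => (h p hp).2
    rw [inf_comm] at h2
    exact θ.iseqv.trans h1 (θ.iseqv.symm h2)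

/-- `Iic p` and `Iio p` differ only at `p`, so this pair detects whether `p` belongs to the set. -/
theorem pointCong_rel_imp_iff {S T : Set P} :
    (∀ U V, (pointCong S).r U V → (pointCong T).r U V) ↔ T ⊆ S := by
  constructor
  · intro h p hp
    by_contra hS
    have : (pointCong T).r (LowerSet.Iic p) (LowerSet.Iio p) := by
      refine h _ _ fun q hq => ?_
      have hne : q ≠ p := by rintro rfl; exact hS hq
      rw [LowerSet.mem_Iic_iff, LowerSet.mem_Iio_iff, lt_iff_le_and_ne]
      exact ⟨fun h => ⟨h, hne⟩, fun h => h.1⟩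
    exact lt_irrefl p ((this p hp).1 (le_refl p))
  · exact fun h U V hUV p hp => hUV p (h hp)

/-- Congruences on the frame of lower sets of a well-founded poset correspond to sets of points. -/
noncomputable def pointCongIso [WellFoundedLT P] : (Set P)ᵒᵈ ≃o FrameCongruence (LowerSet P) :=
  RelIso.ofSurjective
    (OrderEmbedding.ofMapLEIff (fun S : (Set P)ᵒᵈ => pointCong (OrderDual.ofDual S)) fun _ _ =>
      FrameCongruence.le_iff.trans pointCong_rel_imp_iff)
    fun θ => ⟨OrderDual.toDual θ.points, le_antisymm
      (FrameCongruence.le_iff.2 fun U V => (θ.rel_iff_points U V).2)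
      (FrameCongruence.le_iff.2 fun U V => (θ.rel_iff_points U V).1)⟩

theorem openCong_eq_pointCong (a : LowerSet P) :
    FrameCongruence.openCong a = pointCong (a : Set P) := by
  refine le_antisymm (FrameCongruence.le_iff.2 fun U V h p hp => ?_)
    (FrameCongruence.le_iff.2 fun U V h => ?_)
  · have := congrArg (p ∈ ·) (show U ⊓ a = V ⊓ a from h)
    simpa [show p ∈ a from hp] using this
  · change U ⊓ a = V ⊓ a
    ext p
    have := h p
    simp only [SetLike.mem_coe, LowerSet.mem_inf_iff] at this ⊢
    tauto

theorem closedCong_eq_pointCong (a : LowerSet P) :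
    FrameCongruence.closedCong a = pointCong (a : Set P)ᶜ := by
  refine le_antisymm (FrameCongruence.le_iff.2 fun U V h p hp => ?_)
    (FrameCongruence.le_iff.2 fun U V h => ?_)
  · have := congrArg (p ∈ ·) (show U ⊔ a = V ⊔ a from h)
    simpa [show p ∉ a from hp] using this
  · change U ⊔ a = V ⊔ a
    ext p
    have := h p
    simp only [Set.mem_compl_iff, SetLike.mem_coe, LowerSet.mem_sup_iff] at this ⊢
    tauto

/-! ### Sublocales of frames of lower sets -/

/-- Restriction of lower sets to a subset. -/
def restrictHom (S : Set P) : FrameHom (LowerSet P) (LowerSet S) where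
  toFun U := ⟨Subtype.val ⁻¹' (U : Set P), fun _ _ h hx => U.lower h hx⟩
  map_inf' _ _ := rfl
  map_top' := rfl
  map_sSup' A := by
    ext p
    simp
    rfl

theorem restrictHom_eq_iff (S : Set P) (U V : LowerSet P) :
    restrictHom S U = restrictHom S V ↔ (pointCong S).r U V := by
  constructor
  · intro h p hp
    exact iff_of_eq (congrArg ((⟨p, hp⟩ : S) ∈ ·) h)
  · intro h
    ext p
    exact h p.1 p.2

theorem restrictHom_surjective (S : Set P) : Function.Surjective (restrictHom S) := by
  intro V
  refine ⟨lowerClosure (Subtype.val '' (V : Set S)), ?_⟩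
  ext p
  constructor
  · rintro ⟨_, ⟨q, hq, rfl⟩, hpq⟩
    exact V.lower hpq hq
  · intro hp
    exact ⟨p.1, ⟨p, hp, rfl⟩, le_refl _⟩

end Points

section Sublocales

variable {P : Type} [PartialOrder P]

/-- The sublocale of lower sets given by a set of points, as an extremal quotient. -/
def pointQuotient (S : Set P) : ExtremalQuotient (Frm.of (LowerSet P)) :=
  ⟨Frm.of (LowerSet S), Frm.ofHom (restrictHom S),
    frm_extremalEpi_of_surjective _ (restrictHom_surjective S)⟩

theorem pointQuotient_ker (S : Set P) (U V : LowerSet P) :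
    (pointQuotient S).hom U = (pointQuotient S).hom V ↔ (pointCong S).r U V :=
  restrictHom_eq_iff S U V

/-- Sublocales of the frame of lower sets of a well-founded poset correspond to sets of points. -/
noncomputable def pointSub [WellFoundedLT P] : Set P ≃o SubPoset (Frm.of (LowerSet P)) :=
  RelIso.ofSurjective
    (OrderEmbedding.ofMapLEIff (fun S : Set P => SubPoset.mk (pointQuotient S)) fun S T => by
      rw [SubPoset.mk_le_mk_iff_ker, ← pointCong_rel_imp_iff]
      exact forall₂_congr fun U V => by rw [← pointQuotient_ker, ← pointQuotient_ker])
    fun s => by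
      induction s using Quotient.inductionOn with | _ Q
      refine ⟨Q.hom.hom.ker.points, (SubPoset.mk_eq_mk_iff_ker _ Q).2 fun U V => ?_⟩
      exact (pointQuotient_ker _ U V).trans (Q.hom.hom.ker.rel_iff_points U V).symm

variable [WellFoundedLT P]

theorem pointSub_apply (S : Set P) : pointSub S = SubPoset.mk (pointQuotient S) := rfl

theorem pointSub_eq_mk_iff (S : Set P) (Q : ExtremalQuotient (Frm.of (LowerSet P))) :
    pointSub S = SubPoset.mk Q ↔ ∀ U V : LowerSet P, (pointCong S).r U V ↔ Q.hom U = Q.hom V := by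
  rw [pointSub_apply, SubPoset.mk_eq_mk_iff_ker]
  exact forall₂_congr fun U V => by rw [← pointQuotient_ker]

theorem pointSub_open (a : LowerSet P) : pointSub (a : Set P) = openSub a := by
  obtain ⟨Q, h, hQ⟩ := exists_openSub_eq_mk a
  rw [h, pointSub_eq_mk_iff, ← openCong_eq_pointCong]
  exact fun U V => (hQ U V).symm

theorem pointSub_closed (a : LowerSet P) : pointSub (a : Set P)ᶜ = closedSub a := by
  obtain ⟨Q, h, hQ⟩ := exists_closedSub_eq_mk a
  rw [h, pointSub_eq_mk_iff, ← closedCong_eq_pointCong]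
  intro U V
  rw [hQ U V, sup_comm a, sup_comm a]
  rfl

theorem pointSub_empty : pointSub (∅ : Set P) = voidSub (LowerSet P) := by
  obtain ⟨Q, h, hQ⟩ := exists_voidSub_eq_mk (LowerSet P)
  rw [h, pointSub_eq_mk_iff]
  exact fun U V => iff_of_true (fun p hp => hp.elim) (hQ U V)

theorem pointSub_univ : pointSub (Set.univ : Set P) = SubPoset.whole (Frm.of (LowerSet P)) := by
  obtain ⟨Q, h, hQ⟩ := exists_whole_eq_mk (LowerSet P)
  rw [h, pointSub_eq_mk_iff]
  intro U V
  rw [hQ U V]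
  exact ⟨fun h => LowerSet.ext (Set.ext fun p => h p trivial), fun h p _ => by rw [h]⟩

end Sublocales

/-! ### The universal property of a frame of lower sets -/

/-- The frame homomorphism on lower sets which extends a homomorphism of meet-semilattices. -/
def lowerSetLift {P F : Type u} [SemilatticeInf P] [OrderTop P] [Order.Frame F]
    (φ : InfTopHom P F) : FrameHom (LowerSet P) F where
  toFun U := ⨆ p ∈ U, φ p
  map_inf' U V := by
    apply le_antisymm
    · exact le_inf (iSup₂_le fun p hp => le_iSup₂_of_le p hp.1 le_rfl)
        (iSup₂_le fun p hp => le_iSup₂_of_le p hp.2 le_rfl)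
    · rw [iSup₂_inf_eq]
      refine iSup₂_le fun p hp => ?_
      rw [inf_iSup₂_eq]
      refine iSup₂_le fun q hq => ?_
      rw [← map_inf]
      exact le_iSup₂_of_le (p ⊓ q) ⟨U.lower inf_le_left hp, V.lower inf_le_right hq⟩ le_rfl
  map_top' := top_le_iff.1 (le_iSup₂_of_le ⊤ trivial (map_top φ).ge)
  map_sSup' A := by
    apply le_antisymm
    · refine iSup₂_le fun p hp => ?_
      obtain ⟨U, hU, hpU⟩ := LowerSet.mem_sSup_iff.1 hp
      exact le_sSup_of_le ⟨U, hU, rfl⟩ (le_iSup₂_of_le p hpU le_rfl)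
    · refine sSup_le ?_
      rintro _ ⟨U, hU, rfl⟩
      exact iSup₂_le fun p hp => le_iSup₂_of_le p (LowerSet.mem_sSup_iff.2 ⟨U, hU, hp⟩) le_rfl

theorem lowerSetLift_Iic {P F : Type u} [SemilatticeInf P] [OrderTop P] [Order.Frame F]
    (φ : InfTopHom P F) (p : P) : lowerSetLift φ (LowerSet.Iic p) = φ p :=
  le_antisymm (iSup₂_le fun _ hq => OrderHomClass.mono φ hq) (le_iSup₂_of_le p (le_refl p) le_rfl)

/-! ### Subframe closures -/

theorem isSubframe_subframeClosure {F : Type u} [CompleteLattice F] (A : Set F) :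
    IsSubframe (subframeClosure A) where
  top_mem _ hT := hT.1.top_mem
  inf_mem x hx y hy T hT := hT.1.inf_mem x (hx T hT) y (hy T hT)
  sSup_mem B hB T hT := hT.1.sSup_mem B fun _ hx => hB hx T hT

theorem subset_subframeClosure {F : Type u} [CompleteLattice F] (A : Set F) :
    A ⊆ subframeClosure A :=
  fun _ hx _ hT => hT.2 hx

theorem IsSubframe.sup_mem {F : Type u} [CompleteLattice F] {T : Set F} (hT : IsSubframe T)
    {x y : F} (hx : x ∈ T) (hy : y ∈ T) : x ⊔ y ∈ T := by
  rw [← sSup_pair]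
  exact hT.sSup_mem _ (Set.pair_subset hx hy)

theorem IsSubframe.preimage {F G : Type u} [Order.Frame F] [Order.Frame G] (f : FrameHom F G)
    {T : Set G} (hT : IsSubframe T) : IsSubframe (f ⁻¹' T) where
  top_mem := by
    rw [Set.mem_preimage, map_top]
    exact hT.top_mem
  inf_mem x hx y hy := by
    rw [Set.mem_preimage, map_inf]
    exact hT.inf_mem _ hx _ hy
  sSup_mem A hA := by
    rw [Set.mem_preimage, map_sSup]
    exact hT.sSup_mem _ (Set.image_subset_iff.2 hA)

theorem IsSubframe.image {F G : Type u} [Order.Frame F] [Order.Frame G] (f : FrameHom F G)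
    {T : Set F} (hT : IsSubframe T) : IsSubframe (f '' T) where
  top_mem := ⟨⊤, hT.top_mem, map_top f⟩
  inf_mem := by
    rintro _ ⟨x, hx, rfl⟩ _ ⟨y, hy, rfl⟩
    exact ⟨x ⊓ y, hT.inf_mem x hx y hy, map_inf f x y⟩
  sSup_mem A hA := by
    refine ⟨sSup (T ∩ f ⁻¹' A), hT.sSup_mem _ Set.inter_subset_left, ?_⟩
    rw [map_sSup, Set.image_inter_preimage, Set.inter_eq_right.2 hA]

/-- Frame homomorphisms which agree on a generating set are equal. -/
theorem FrameHom.eq_of_eqOn_generators {F G : Type u} [Order.Frame F] [Order.Frame G]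
    {A : Set F} (hA : subframeClosure A = Set.univ) (f g : FrameHom F G)
    (h : ∀ x ∈ A, f x = g x) : f = g := by
  have hT : IsSubframe {x | f x = g x} :=
    { top_mem := by simp
      inf_mem := fun x hx y hy => by
        simp only [Set.mem_ofPred_eq] at hx hy ⊢
        rw [map_inf, map_inf, hx, hy]
      sSup_mem := fun B hB => by
        rw [Set.mem_ofPred_eq, map_sSup, map_sSup]
        exact congrArg sSup (Set.image_congr hB) }
  ext x
  have hx : x ∈ subframeClosure A := hA ▸ Set.mem_univ x
  exact hx _ ⟨hT, h⟩

theorem frameHom_chain_ext {G : Type} [Order.Frame G] {f g : FrameHom (Fin 3) G}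
    (h : f 1 = g 1) : f = g := by
  ext i
  fin_cases i
  · exact (map_bot f).trans (map_bot g).symm
  · exact h
  · exact (map_top f).trans (map_top g).symm

/-! ### Monomorphisms and quotients of biframes -/

namespace BiFrm

theorem hom_ext_apply {L M : BiFrm.{u}} {f g : L ⟶ M}
    (h : ∀ x, f.toFrameHom x = g.toFrameHom x) : f = g :=
  Hom.ext (FrameHom.ext h)

/-- The components of the source generate its ambient frame, so two homomorphisms are equal once
they agree there, and on the components their values stay inside those of `L`. -/
theorem mono_of_injOn {L M : BiFrm.{u}} (m : L ⟶ M) (h₁ : Set.InjOn m.toFrameHom L.fst)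
    (h₂ : Set.InjOn m.toFrameHom L.snd) : Mono m where
  right_cancellation {K} f g e := by
    refine Hom.ext (FrameHom.eq_of_eqOn_generators K.generates _ _ ?_)
    have he : ∀ x, m.toFrameHom (f.toFrameHom x) = m.toFrameHom (g.toFrameHom x) := fun x =>
      congrArg (fun k : K ⟶ M => k.toFrameHom x) e
    rintro x (hx | hx)
    · exact h₁ (f.map_fst x hx) (g.map_fst x hx) (he x)
    · exact h₂ (f.map_snd x hx) (g.map_snd x hx) (he x)

theorem isSubframe_univ (F : Type u) [CompleteLattice F] : IsSubframe (Set.univ : Set F) :=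
  ⟨trivial, fun _ _ _ _ => trivial, fun _ _ => trivial⟩

theorem isSubframe_bot_top (F : Type u) [CompleteLattice F] : IsSubframe ({⊥, ⊤} : Set F) where
  top_mem := Or.inr rfl
  inf_mem := by
    rintro x (rfl | rfl) y hy
    · left; simp
    · simpa using hy
  sSup_mem A hA := by
    by_cases h : ⊤ ∈ A
    · exact Or.inr (top_le_iff.1 (le_sSup h))
    · refine Or.inl (le_bot_iff.1 (sSup_le fun x hx => ?_))
      rcases hA hx with rfl | rfl
      · exact le_rfl
      · exact absurd hx h

theorem subframeClosure_eq_univ {F : Type u} [CompleteLattice F] {A : Set F}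
    (h : ∀ x, x ∈ A) : subframeClosure A = Set.univ :=
  Set.eq_univ_of_forall fun x => subset_subframeClosure A (h x)

/-- The biframe with ambient frame and first component `𝟑` and trivial second component. -/
noncomputable def chainFst : BiFrm.{0} where
  ambient := Fin 3
  fst := Set.univ
  snd := {⊥, ⊤}
  isSubframe_fst := isSubframe_univ _
  isSubframe_snd := isSubframe_bot_top _
  generates := subframeClosure_eq_univ fun _ => Or.inl trivial

/-- The biframe with ambient frame and second component `𝟑` and trivial first component. -/
noncomputable def chainSnd : BiFrm.{0} where
  ambient := Fin 3
  fst := {⊥, ⊤}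
  snd := Set.univ
  isSubframe_fst := isSubframe_bot_top _
  isSubframe_snd := isSubframe_univ _
  generates := subframeClosure_eq_univ fun _ => Or.inr trivial

theorem IsSubframe.chainHom_mem {F : Type u} [Order.Frame F] {T : Set F} (hT : IsSubframe T)
    {x : F} (hx : x ∈ T) (i : Fin 3) : chainHom x i ∈ T := by
  fin_cases i
  · have := hT.sSup_mem ∅ (Set.empty_subset _)
    rwa [sSup_empty] at this
  · exact hx
  · exact hT.top_mem

theorem IsSubframe.map_bot_top_mem {F G : Type u} [Order.Frame F] [Order.Frame G]
    (f : FrameHom F G) {T : Set G} (hT : IsSubframe T) :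
    ∀ x ∈ ({⊥, ⊤} : Set F), f x ∈ T := by
  rintro x (rfl | rfl)
  · rw [map_bot, ← sSup_empty]
    exact hT.sSup_mem ∅ (Set.empty_subset _)
  · rw [map_top]
    exact hT.top_mem

/-- The homomorphism from `chainFst` picking an element of the first component. -/
def chainFstHom {N : BiFrm.{0}} (x : N.ambient) (hx : x ∈ N.fst) : chainFst ⟶ N :=
  Hom.mk (L := chainFst) (chainHom x) (fun i _ => IsSubframe.chainHom_mem N.isSubframe_fst hx i)
    (IsSubframe.map_bot_top_mem _ N.isSubframe_snd)

/-- The homomorphism from `chainSnd` picking an element of the second component. -/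
def chainSndHom {N : BiFrm.{0}} (x : N.ambient) (hx : x ∈ N.snd) : chainSnd ⟶ N :=
  Hom.mk (L := chainSnd) (chainHom x) (IsSubframe.map_bot_top_mem _ N.isSubframe_fst)
    (fun i _ => IsSubframe.chainHom_mem N.isSubframe_snd hx i)

/-- `chainFst` represents the first component: its other component is trivial, so a homomorphism out
of it amounts to an element of `N.fst`. -/
theorem injOn_fst_of_mono {N M : BiFrm.{0}} (m : N ⟶ M) [Mono m] :
    Set.InjOn m.toFrameHom N.fst := by
  intro x hx y hy hxy
  have h : chainFstHom x hx ≫ m = chainFstHom y hy ≫ m :=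
    Hom.ext (frameHom_chain_ext hxy)
  exact congrArg (fun k : chainFst ⟶ N => k.toFrameHom (1 : Fin 3)) ((cancel_mono m).1 h)

theorem injOn_snd_of_mono {N M : BiFrm.{0}} (m : N ⟶ M) [Mono m] :
    Set.InjOn m.toFrameHom N.snd := by
  intro x hx y hy hxy
  have h : chainSndHom x hx ≫ m = chainSndHom y hy ≫ m :=
    Hom.ext (frameHom_chain_ext hxy)
  exact congrArg (fun k : chainSnd ⟶ N => k.toFrameHom (1 : Fin 3)) ((cancel_mono m).1 h)

/-- The quotient of a biframe along a surjective homomorphism of its ambient frame. -/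
def quotient (L : BiFrm.{u}) {F : Type u} [Order.Frame F] (q : FrameHom L.ambient F)
    (hq : Function.Surjective q) : BiFrm.{u} where
  ambient := F
  fst := q '' L.fst
  snd := q '' L.snd
  isSubframe_fst := L.isSubframe_fst.image q
  isSubframe_snd := L.isSubframe_snd.image q
  generates := by
    apply Set.eq_univ_of_forall
    rintro y T ⟨hT, hA⟩
    obtain ⟨x, rfl⟩ := hq y
    have hx : x ∈ subframeClosure (L.fst ∪ L.snd) := L.generates ▸ Set.mem_univ x
    refine hx (q ⁻¹' T) ⟨hT.preimage q, ?_⟩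
    rintro z (hz | hz)
    · exact hA (Or.inl ⟨z, hz, rfl⟩)
    · exact hA (Or.inr ⟨z, hz, rfl⟩)

section Quotient

variable (L : BiFrm.{u}) {F : Type u} [Order.Frame F] (q : FrameHom L.ambient F)
  (hq : Function.Surjective q)

/-- The quotient homomorphism. -/
def quotientHom : L ⟶ L.quotient q hq :=
  Hom.mk (M := L.quotient q hq) q (fun x hx => ⟨x, hx, rfl⟩) (fun x hx => ⟨x, hx, rfl⟩)

theorem epi_quotientHom : Epi (L.quotientHom q hq) where
  left_cancellation g h e := by
    refine hom_ext_apply fun y => ?_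
    obtain ⟨x, rfl⟩ := hq y
    exact congrArg (fun k : L ⟶ _ => k.toFrameHom x) e

variable {L}

/-- Homomorphisms out of a quotient. -/
noncomputable def quotientDesc {M : BiFrm.{u}} (f : L ⟶ M)
    (h : ∀ x y, q x = q y → f.toFrameHom x = f.toFrameHom y) : L.quotient q hq ⟶ M :=
  Hom.mk (L := L.quotient q hq) (q.descend hq f.toFrameHom h)
    (by
      rintro _ ⟨x, hx, rfl⟩
      exact (FrameHom.descend_apply q hq f.toFrameHom h x).symm ▸ f.map_fst x hx)
    (by
      rintro _ ⟨x, hx, rfl⟩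
      exact (FrameHom.descend_apply q hq f.toFrameHom h x).symm ▸ f.map_snd x hx)

theorem quotientHom_desc {M : BiFrm.{u}} (f : L ⟶ M)
    (h : ∀ x y, q x = q y → f.toFrameHom x = f.toFrameHom y) :
    L.quotientHom q hq ≫ quotientDesc q hq f h = f :=
  hom_ext_apply fun x => FrameHom.descend_apply q hq f.toFrameHom h x

end Quotient

end BiFrm

/-! ### Extremal quotients of `𝟑.𝟑` -/

open BiFrm

/-- Elements of the first component are unions of fibres of the first projection; this is what makes
projections of point sets relevant. -/
theorem mem_fst_threeThree {u : ThreeSumThree} (hu : u ∈ threeThree.fst) (b c c' : Bool) :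
    (b, c) ∈ u ↔ (b, c') ∈ u := by
  obtain ⟨i, rfl⟩ := hu
  fin_cases i
  · exact Iff.rfl
  · change (b, c) ≤ (false, true) ↔ (b, c') ≤ (false, true)
    revert b c c'
    decide
  · exact Iff.rfl

theorem mem_snd_threeThree {u : ThreeSumThree} (hu : u ∈ threeThree.snd) (b b' c : Bool) :
    (b, c) ∈ u ↔ (b', c) ∈ u := by
  obtain ⟨i, rfl⟩ := hu
  fin_cases i
  · exact Iff.rfl
  · change (b, c) ≤ (true, false) ↔ (b', c) ≤ (true, false)
    revert b b' c
    decide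
  · exact Iff.rfl

/-- Consecutive members of the chain `0 < a < 1` differ in exactly one fibre. -/
theorem exists_fst_separating (b : Bool) :
    ∃ u v : ThreeSumThree, u ∈ threeThree.fst ∧ v ∈ threeThree.fst ∧
    ∀ b' c, (((b', c) ∈ u) ↔ (b', c) ∈ v) ↔ b' ≠ b := by
  cases b
  · refine ⟨_, _, ⟨1, rfl⟩, ⟨0, rfl⟩, fun b' c => ?_⟩
    change (((b', c) ≤ (false, true)) ↔ False) ↔ b' ≠ false
    revert b' c
    decide
  · refine ⟨_, _, ⟨1, rfl⟩, ⟨2, rfl⟩, fun b' c => ?_⟩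
    change (((b', c) ≤ (false, true)) ↔ True) ↔ b' ≠ true
    revert b' c
    decide

theorem exists_snd_separating (c : Bool) :
    ∃ u v : ThreeSumThree, u ∈ threeThree.snd ∧ v ∈ threeThree.snd ∧
    ∀ b c', (((b, c') ∈ u) ↔ (b, c') ∈ v) ↔ c' ≠ c := by
  cases c
  · refine ⟨_, _, ⟨1, rfl⟩, ⟨0, rfl⟩, fun b c' => ?_⟩
    change (((b, c') ≤ (true, false)) ↔ False) ↔ c' ≠ false
    revert b c'
    decide
  · refine ⟨_, _, ⟨1, rfl⟩, ⟨2, rfl⟩, fun b c' => ?_⟩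
    change (((b, c') ≤ (true, false)) ↔ True) ↔ c' ≠ true
    revert b c'
    decide

/-- The quotient biframe of `𝟑.𝟑` given by a set of points. -/
def pointBiframe (S : Set (Bool × Bool)) : BiFrm.{0} :=
  threeThree.quotient (restrictHom S) (restrictHom_surjective S)

/-- The restriction homomorphism onto `pointBiframe S`. -/
def pointBiframeHom (S : Set (Bool × Bool)) : threeThree ⟶ pointBiframe S :=
  threeThree.quotientHom (restrictHom S) (restrictHom_surjective S)

theorem pointBiframeHom_eq_iff (S : Set (Bool × Bool)) (U V : ThreeSumThree) :
    (pointBiframeHom S).toFrameHom U = (pointBiframeHom S).toFrameHom V ↔ (pointCong S).r U V :=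
  restrictHom_eq_iff S U V

/-- The points not collapsed by a homomorphism out of `𝟑.𝟑`. -/
def homPoints {M : BiFrm.{0}} (f : threeThree ⟶ M) : Set (Bool × Bool) :=
  (FrameHom.ker (F := ThreeSumThree) f.toFrameHom).points

theorem hom_eq_iff {M : BiFrm.{0}} (f : threeThree ⟶ M) (U V : ThreeSumThree) :
    f.toFrameHom U = f.toFrameHom V ↔ (pointCong (homPoints f)).r U V :=
  (FrameHom.ker (F := ThreeSumThree) f.toFrameHom).rel_iff_points U V

theorem exists_desc_iff {M : BiFrm.{0}} (f : threeThree ⟶ M) (S : Set (Bool × Bool)) :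
    (∃ h : pointBiframe S ⟶ M, pointBiframeHom S ≫ h = f) ↔ homPoints f ⊆ S := by
  rw [← pointCong_rel_imp_iff]
  constructor
  · rintro ⟨h, hh⟩ U V hUV
    rw [← hom_eq_iff, ← hh]
    exact congrArg h.toFrameHom ((pointBiframeHom_eq_iff S U V).2 hUV)
  · intro h
    exact ⟨_, quotientHom_desc (L := threeThree) (restrictHom S) (restrictHom_surjective S) f
      fun U V hUV => (hom_eq_iff f U V).2 (h U V ((restrictHom_eq_iff S U V).1 hUV))⟩

/-- A set of points is a rectangle if it is a product of sets of coordinates. -/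
def IsRectangle (S : Set (Bool × Bool)) : Prop :=
  ∀ p ∈ S, ∀ q ∈ S, (p.1, q.2) ∈ S

/-- Let the quotient factor as `p` followed by a mono `m`. Injectivity of `m` on the components
forces both coordinates of each point of `p` to occur as coordinates in `S`; as `S` is a rectangle,
the points of `p` lie in `S`. Thus `p` factors back through the quotient, and the resulting map
inverts `m`. -/
theorem extremalEpi_pointBiframeHom {S : Set (Bool × Bool)} (hS : IsRectangle S) :
    ExtremalEpi (pointBiframeHom S) where
  toEpi := threeThree.epi_quotientHom _ _
  isIso := by
    intro N p m fac hm
    have := threeThree.epi_quotientHom (restrictHom S) (restrictHom_surjective S)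
    have hep : Epi (pointBiframeHom S) := this
    have hmp : ∀ u, m.toFrameHom (p.toFrameHom u) = (pointBiframeHom S).toFrameHom u := fun u =>
      congrArg (fun k : threeThree ⟶ pointBiframe S => k.toFrameHom u) fac
    have h₁ : ∀ b c, (b, c) ∈ homPoints p → ∃ c', (b, c') ∈ S := by
      intro b c hbc
      -- If the fibre over `b` misses `S`, the separating pair agrees on `S`, so `p` identifies it
      -- although it differs at `(b, c)`, an uncollapsed point of `p`.
      by_contra! hn
      obtain ⟨u, v, hu, hv, huv⟩ := exists_fst_separating b
      refine (huv b c).1 ((hom_eq_iff p u v).1 ?_ _ hbc) rfl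
      refine injOn_fst_of_mono m (p.map_fst u hu) (p.map_fst v hv)
        ((hmp u).trans (Eq.trans ?_ (hmp v).symm))
      refine (pointBiframeHom_eq_iff S u v).2 ?_
      rintro ⟨b', c'⟩ hS'
      exact (huv b' c').2 (by rintro rfl; exact hn c' hS')
    have h₂ : ∀ b c, (b, c) ∈ homPoints p → ∃ b', (b', c) ∈ S := by
      intro b c hbc
      by_contra! hn
      obtain ⟨u, v, hu, hv, huv⟩ := exists_snd_separating c
      refine (huv b c).1 ((hom_eq_iff p u v).1 ?_ _ hbc) rfl
      refine injOn_snd_of_mono m (p.map_snd u hu) (p.map_snd v hv)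
        ((hmp u).trans (Eq.trans ?_ (hmp v).symm))
      refine (pointBiframeHom_eq_iff S u v).2 ?_
      rintro ⟨b', c'⟩ hS'
      exact (huv b' c').2 (by rintro rfl; exact hn b' hS')
    obtain ⟨n, hn⟩ := (exists_desc_iff p S).2 (by
      rintro ⟨b, c⟩ hbc
      obtain ⟨c', hc⟩ := h₁ b c hbc
      obtain ⟨b', hb⟩ := h₂ b c hbc
      exact hS _ hc _ hb)
    have hnm : n ≫ m = 𝟙 _ := by
      rw [← cancel_epi (pointBiframeHom S), ← Category.assoc, hn, fac, Category.comp_id]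
    refine ⟨n, ?_, hnm⟩
    rw [← cancel_mono m, Category.assoc, hnm, Category.comp_id, Category.id_comp]

/-- The extremal quotient of `𝟑.𝟑` given by a rectangle. -/
def rectangleQuotient (S : Set (Bool × Bool)) (hS : IsRectangle S) : ExtremalQuotient threeThree :=
  ⟨pointBiframe S, pointBiframeHom S, extremalEpi_pointBiframeHom hS⟩

/-- The rectangle is the product of the two projections of the points of `f`. Enlarging the point
set to it changes nothing on either component, so the comparison map is monic and extremality makes
it invertible. -/
theorem exists_isIso_of_extremalEpi {M : BiFrm.{0}} (f : threeThree ⟶ M) (hf : ExtremalEpi f) :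
    ∃ S, IsRectangle S ∧ ∃ m : pointBiframe S ⟶ M, IsIso m ∧ pointBiframeHom S ≫ m = f := by
  let S : Set (Bool × Bool) :=
    {p | (∃ c, (p.1, c) ∈ homPoints f) ∧ ∃ b, (b, p.2) ∈ homPoints f}
  obtain ⟨m, hm⟩ := (exists_desc_iff f S).2 fun p hp => ⟨⟨p.2, hp⟩, ⟨p.1, hp⟩⟩
  refine ⟨S, fun p hp q hq => ⟨hp.1, hq.2⟩, m, ?_, hm⟩
  have hmf : ∀ u, m.toFrameHom ((pointBiframeHom S).toFrameHom u) = f.toFrameHom u := fun u =>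
    congrArg (fun k : threeThree ⟶ M => k.toFrameHom u) hm
  have : Mono m := by
    apply mono_of_injOn
    · rintro _ ⟨u, hu, rfl⟩ _ ⟨v, hv, rfl⟩ huv
      have huv' := (hom_eq_iff f u v).1 ((hmf u).symm.trans (huv.trans (hmf v)))
      refine (pointBiframeHom_eq_iff S u v).2 ?_
      rintro ⟨b, c⟩ ⟨⟨c', hc⟩, -⟩
      rw [mem_fst_threeThree hu b c c', mem_fst_threeThree hv b c c']
      exact huv' _ hc
    · rintro _ ⟨u, hu, rfl⟩ _ ⟨v, hv, rfl⟩ huv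
      have huv' := (hom_eq_iff f u v).1 ((hmf u).symm.trans (huv.trans (hmf v)))
      refine (pointBiframeHom_eq_iff S u v).2 ?_
      rintro ⟨b, c⟩ ⟨-, ⟨b', hb⟩⟩
      rw [mem_snd_threeThree hu b b' c, mem_snd_threeThree hv b b' c]
      exact huv' _ hb
  exact hf.isIso (pointBiframeHom S) m hm

/-- Rectangles, ordered by inclusion. -/
abbrev Rectangle : Type := {S : Set (Bool × Bool) // IsRectangle S}

theorem homPoints_pointBiframeHom (S : Set (Bool × Bool)) : homPoints (pointBiframeHom S) = S := by
  apply Set.Subset.antisymm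
  · exact (exists_desc_iff _ S).1 ⟨𝟙 _, Category.comp_id _⟩
  · exact pointCong_rel_imp_iff.1 fun U V h =>
      (pointBiframeHom_eq_iff S U V).1 ((hom_eq_iff _ U V).2 h)

/-- The subbilocales of `𝟑.𝟑` are given by the rectangles. -/
noncomputable def rectangleSub : Rectangle ≃o SubPoset threeThree :=
  RelIso.ofSurjective
    (OrderEmbedding.ofMapLEIff
      (fun S : Rectangle => SubPoset.mk (rectangleQuotient S.1 S.2)) fun S T => by
        refine (exists_desc_iff (pointBiframeHom S.1) T.1).trans ?_
        rw [homPoints_pointBiframeHom]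
        rfl)
    fun s => by
      induction s using Quotient.inductionOn with | _ Q
      obtain ⟨S, hS, m, hm, fac⟩ := exists_isIso_of_extremalEpi Q.hom Q.extremal
      refine ⟨⟨S, hS⟩, le_antisymm ?_ ?_⟩
      · refine SubPoset.mk_le_mk.2 ⟨(inv m : Q.obj ⟶ pointBiframe S), ?_⟩
        exact (IsIso.comp_inv_eq m).2 fac.symm
      · exact SubPoset.mk_le_mk.2 ⟨m, fac⟩

/-- Up to isomorphism the quotient is restriction to a rectangle, which is onto on the ambient
frame. -/
theorem extremalEpi_ambient (Q : ExtremalQuotient threeThree) :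
    ExtremalEpi (ambientFunctor.map Q.hom) := by
  obtain ⟨S, hS, m, hm, fac⟩ := exists_isIso_of_extremalEpi Q.hom Q.extremal
  apply frm_extremalEpi_of_surjective
  intro y
  obtain ⟨x, hx⟩ := restrictHom_surjective S ((inv m).toFrameHom y)
  refine ⟨x, ?_⟩
  change Q.hom.toFrameHom x = y
  rw [← fac]
  refine (congrArg m.toFrameHom hx).trans ?_
  exact congrArg (fun k : Q.obj ⟶ Q.obj => k.toFrameHom y) (IsIso.inv_hom_id m)

/-- The embedding of the subbilocales of `𝟑.𝟑` into the sublocales of `𝟑 ⊕ 𝟑`. -/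
noncomputable def ambientEmbedding : SubPoset threeThree ↪o SubPoset (Frm.of ThreeSumThree) :=
  (rectangleSub.symm.toOrderEmbedding.trans (OrderEmbedding.subtype _)).trans
    pointSub.toOrderEmbedding

theorem ambientEmbedding_rectangleSub (S : Rectangle) :
    ambientEmbedding (rectangleSub S) = pointSub S.1 := by
  change pointSub (rectangleSub.symm (rectangleSub S)).1 = _
  rw [OrderIso.symm_apply_apply]

theorem ambientEmbedding_mk (Q : ExtremalQuotient threeThree) :
    ambientEmbedding (SubPoset.mk Q) =
      SubPoset.mk ⟨_, ambientFunctor.map Q.hom, extremalEpi_ambient Q⟩ := by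
  obtain ⟨S, hS⟩ := rectangleSub.surjective (SubPoset.mk Q)
  rw [← hS, ambientEmbedding_rectangleSub, pointSub_apply]
  obtain ⟨⟨h, hh⟩, ⟨k, hk⟩⟩ :
      rectangleQuotient S.1 S.2 ≤ Q ∧ Q ≤ rectangleQuotient S.1 S.2 :=
    ⟨SubPoset.mk_le_mk.1 hS.le, SubPoset.mk_le_mk.1 hS.ge⟩
  refine le_antisymm (SubPoset.mk_le_mk.2 ⟨ambientFunctor.map h, ?_⟩)
    (SubPoset.mk_le_mk.2 ⟨ambientFunctor.map k, ?_⟩)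
  · exact (ambientFunctor.map_comp Q.hom h).symm.trans (congrArg ambientFunctor.map hh)
  · exact (ambientFunctor.map_comp (pointBiframeHom S.1) k).symm.trans
      (congrArg ambientFunctor.map hk)

theorem range_ambientEmbedding :
    Set.range ambientEmbedding = {s | ∃ S, IsRectangle S ∧ pointSub S = s} := by
  ext s
  constructor
  · rintro ⟨t, rfl⟩
    obtain ⟨S, rfl⟩ := rectangleSub.surjective t
    exact ⟨S.1, S.2, (ambientEmbedding_rectangleSub S).symm⟩
  · rintro ⟨S, hS, rfl⟩
    exact ⟨_, ambientEmbedding_rectangleSub ⟨S, hS⟩⟩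

/-! ### The Hasse diagram of `𝒮(𝟑.𝟑)` -/

theorem coe_inclLeft_one :
    ((inclLeft 1 : ThreeSumThree) : Set (Bool × Bool)) = {p | p.1 = false} := by
  ext p
  change p ≤ (false, true) ↔ p.1 = false
  revert p
  decide

theorem coe_inclRight_one :
    ((inclRight 1 : ThreeSumThree) : Set (Bool × Bool)) = {p | p.2 = false} := by
  ext p
  change p ≤ (true, false) ↔ p.2 = false
  revert p
  decide

instance : Fintype Node where
  elems := ⟨↑[Node.whole, .c₁, .c₂, .o₂, .o₁, .c₁c₂, .c₁o₂, .c₂o₁, .o₁o₂, .void], by simp⟩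
  complete n := by cases n <;> simp

/-- The rectangle of points of a node of the Hasse diagram. -/
def Node.points : Node → Finset (Bool × Bool)
  | .whole => Finset.univ
  | .c₁ => {p | p.1 = true}
  | .c₂ => {p | p.2 = true}
  | .o₂ => {p | p.2 = false}
  | .o₁ => {p | p.1 = false}
  | .c₁c₂ => {(true, true)}
  | .c₁o₂ => {(true, false)}
  | .c₂o₁ => {(false, true)}
  | .o₁o₂ => {(false, false)}
  | .void => ∅

theorem Node.isRectangle (n : Node) : IsRectangle (n.points : Set (Bool × Bool)) := by
  have : ∀ n : Node, ∀ p ∈ n.points, ∀ q ∈ n.points, (p.1, q.2) ∈ n.points := by decide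
  exact this n

theorem Node.exists_points_eq : ∀ F : Finset (Bool × Bool),
    (∀ p ∈ F, ∀ q ∈ F, (p.1, q.2) ∈ F) → ∃ n : Node, n.points = F := by
  decide

theorem Node.points_injective : Function.Injective Node.points := by
  intro m n
  cases m <;> cases n <;> first | exact fun _ => rfl | exact fun h => absurd h (by decide)

theorem edge_iff (p q : Node) : Edge p q ↔
    p.points ⊂ q.points ∧ ∀ r : Node, ¬ (p.points ⊂ r.points ∧ r.points ⊂ q.points) := by
  constructor
  · intro h
    cases h <;> decide
  · cases p <;> cases q <;> first
    | exact fun _ => by constructor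
    | exact fun h => absurd h (by decide)

/-- In a finite poset the order is generated by the covering relation; the induction is on the size
of the larger rectangle. -/
theorem reflTransGen_edge_iff (p q : Node) :
    Relation.ReflTransGen Edge p q ↔ p.points ⊆ q.points := by
  constructor
  · intro h
    induction h with
    | refl => exact subset_rfl
    | tail _ h ih => exact ih.trans ((edge_iff _ _).1 h).1.1
  · induction hn : q.points.card using Nat.strong_induction_on generalizing q with | _ n ih
    intro hpq
    by_cases he : p = q
    · exact he ▸ .refl
    have key : ∀ p q : Node, p.points ⊆ q.points → p.points ≠ q.points →
        ∃ r : Node, p.points ⊆ r.points ∧ (r.points ⊂ q.points ∧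
          ∀ s : Node, ¬ (r.points ⊂ s.points ∧ s.points ⊂ q.points)) := by decide
    obtain ⟨r, hpr, hrq⟩ := key p q hpq fun h => he (Node.points_injective h)
    exact .tail (ih _ (hn ▸ Finset.card_lt_card hrq.1) r rfl hpr) ((edge_iff r q).2 hrq)

/-- The nodes of the Hasse diagram correspond to the rectangles. -/
noncomputable def nodeRectangle : Node ≃ Rectangle :=
  Equiv.ofBijective (fun n => ⟨n.points, n.isRectangle⟩) <| by
    constructor
    · intro m n h
      exact Node.points_injective (Finset.coe_injective (congrArg Subtype.val h))
    · rintro ⟨S, hS⟩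
      obtain ⟨n, hn⟩ := Node.exists_points_eq (Set.toFinite S).toFinset (by
        simp only [Set.Finite.mem_toFinset]
        exact hS)
      refine ⟨n, Subtype.ext ?_⟩
      change (n.points : Set (Bool × Bool)) = S
      rw [hn, Set.Finite.coe_toFinset]

/-- The nodes of the Hasse diagram correspond to the subbilocales of `𝟑.𝟑`. -/
noncomputable def nodeSub : Node ≃ SubPoset threeThree :=
  nodeRectangle.trans rectangleSub.toEquiv

theorem nodeSub_le_iff (p q : Node) : nodeSub p ≤ nodeSub q ↔ p.points ⊆ q.points :=
  rectangleSub.le_iff_le.trans Finset.coe_subset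

theorem nodeSub_lt_iff (p q : Node) : nodeSub p < nodeSub q ↔ p.points ⊂ q.points := by
  rw [lt_iff_le_not_ge, nodeSub_le_iff, nodeSub_le_iff]
  rfl

theorem nodeSub_covBy_iff (p q : Node) : nodeSub p ⋖ nodeSub q ↔ Edge p q := by
  rw [edge_iff, CovBy, nodeSub_lt_iff]
  refine and_congr_right fun _ => ?_
  rw [nodeSub.surjective.forall]
  exact forall_congr' fun r => by rw [nodeSub_lt_iff, nodeSub_lt_iff, not_and]

theorem ambientEmbedding_nodeSub (n : Node) :
    ambientEmbedding (nodeSub n) = pointSub (n.points : Set (Bool × Bool)) :=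
  ambientEmbedding_rectangleSub _

/-! ### The image of the embedding as a generated meet-semilattice. -/

theorem pointSub_isGLB (S T : Set (Bool × Bool)) :
    IsGLB {pointSub S, pointSub T} (pointSub (S ∩ T)) := by
  rw [← Set.image_pair, OrderIso.isGLB_image']
  exact isGLB_pair

theorem isLeast_range_ambientEmbedding :
    IsLeast {T : Set (SubPoset (Frm.of ThreeSumThree)) |
      {openSub (inclLeft 1 : ThreeSumThree), openSub (inclRight 1 : ThreeSumThree),
        closedSub (inclLeft 1 : ThreeSumThree), closedSub (inclRight 1 : ThreeSumThree),
          SubPoset.whole (Frm.of ThreeSumThree), voidSub ThreeSumThree} ⊆ T ∧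
        ∀ s ∈ T, ∀ t ∈ T, ∀ m, IsGLB {s, t} m → m ∈ T} (Set.range ambientEmbedding) := by
  rw [range_ambientEmbedding, ← pointSub_open, ← pointSub_open, ← pointSub_closed,
    ← pointSub_closed, ← pointSub_univ, ← pointSub_empty, coe_inclLeft_one, coe_inclRight_one]
  refine ⟨⟨?_, ?_⟩, ?_⟩
  · rintro _ (rfl | rfl | rfl | rfl | rfl | rfl)
    · exact ⟨_, fun p hp q hq => hp, rfl⟩
    · exact ⟨_, fun p hp q hq => hq, rfl⟩
    · exact ⟨_, fun p hp q hq => hp, rfl⟩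
    · exact ⟨_, fun p hp q hq => hq, rfl⟩
    · exact ⟨Set.univ, fun p hp q hq => trivial, rfl⟩
    · exact ⟨_, fun p hp q hq => hp, rfl⟩
  · rintro _ ⟨S, hS, rfl⟩ _ ⟨T, hT, rfl⟩ m hm
    refine ⟨S ∩ T, fun p hp q hq => ⟨hS p hp.1 q hq.1, hT p hp.2 q hq.2⟩, ?_⟩
    exact (pointSub_isGLB S T).unique hm
  · rintro T ⟨hT, hinf⟩ _ ⟨S, hS, rfl⟩
    have h₁ : pointSub {p : Bool × Bool | p.1 = false} ∈ T := hT (by simp)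
    have h₂ : pointSub {p : Bool × Bool | p.2 = false} ∈ T := hT (by simp)
    have h₃ : pointSub {p : Bool × Bool | p.1 = false}ᶜ ∈ T := hT (by simp)
    have h₄ : pointSub {p : Bool × Bool | p.2 = false}ᶜ ∈ T := hT (by simp)
    have h₅ : pointSub (Set.univ : Set (Bool × Bool)) ∈ T := hT (by simp)
    have h₆ : pointSub (∅ : Set (Bool × Bool)) ∈ T := hT (by simp)
    have h : ∀ A B : Set (Bool × Bool), pointSub A ∈ T → pointSub B ∈ T → pointSub (A ∩ B) ∈ T :=
      fun A B hA hB => hinf _ hA _ hB _ (pointSub_isGLB A B)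
    obtain ⟨n, hn⟩ := nodeRectangle.surjective ⟨S, hS⟩
    have hn' : (n.points : Set (Bool × Bool)) = S := congrArg Subtype.val hn
    rw [← hn']
    -- Every rectangle is empty, the whole square, one of the four half-squares, or an intersection
    -- of two of these.
    cases n
    · convert h₅; ext p; simp [Node.points]
    · convert h₃; ext p; simp [Node.points]
    · convert h₄; ext p; simp [Node.points]
    · convert h₂; ext p; simp [Node.points]
    · convert h₁; ext p; simp [Node.points]
    · convert h _ _ h₃ h₄; ext p; simp [Node.points, Prod.ext_iff]
    · convert h _ _ h₃ h₂; ext p; simp [Node.points, Prod.ext_iff]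
    · convert h _ _ h₁ h₄; ext p; simp [Node.points, Prod.ext_iff]
    · convert h _ _ h₁ h₂; ext p; simp [Node.points, Prod.ext_iff]
    · convert h₆; ext p; simp [Node.points]

/-! ### The six elements of `𝟑 ⊕ 𝟑`. -/

theorem hasse_sum (x : ThreeSumThree) :
    x = ⊥ ∨ x = inclLeft 1 ⊓ inclRight 1 ∨ x = inclLeft 1 ∨ x = inclRight 1 ∨
      x = inclLeft 1 ⊔ inclRight 1 ∨ x = ⊤ := by
  have key : ∀ F : Finset (Bool × Bool), (∀ p ∈ F, ∀ q, q ≤ p → q ∈ F) →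
      F = ∅ ∨ F = Finset.univ.filter (fun p => p.1 = false ∧ p.2 = false) ∨
        F = Finset.univ.filter (fun p => p.1 = false) ∨
        F = Finset.univ.filter (fun p => p.2 = false) ∨
        F = Finset.univ.filter (fun p => p.1 = false ∨ p.2 = false) ∨ F = Finset.univ := by decide
  have hF := key (Set.toFinite (x : Set (Bool × Bool))).toFinset fun p hp q hqp => by
    rw [Set.Finite.mem_toFinset] at hp ⊢
    exact x.lower hqp hp
  simpa only [← SetLike.coe_set_eq, LowerSet.coe_inf, LowerSet.coe_sup, LowerSet.coe_bot,
    LowerSet.coe_top, coe_inclLeft_one, coe_inclRight_one, ← Finset.coe_inj,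
    Set.Finite.coe_toFinset, Finset.coe_empty, Finset.coe_univ, Finset.coe_filter,
    Finset.mem_univ, true_and, Set.ofPred_and, Set.ofPred_or] using hF

theorem hasse_sum_order : (⊥ : ThreeSumThree) < inclLeft 1 ⊓ inclRight 1 ∧
    ¬ inclLeft 1 ≤ inclRight 1 ∧ ¬ inclRight 1 ≤ inclLeft 1 ∧
    (inclLeft 1 ⊔ inclRight 1 : ThreeSumThree) < ⊤ := by
  have hl : ∀ p, p ∈ (inclLeft 1 : ThreeSumThree) ↔ p.1 = false := fun p =>
    Set.ext_iff.1 coe_inclLeft_one p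
  have hr : ∀ p, p ∈ (inclRight 1 : ThreeSumThree) ↔ p.2 = false := fun p =>
    Set.ext_iff.1 coe_inclRight_one p
  refine ⟨bot_lt_iff_ne_bot.2 fun h => ?_, fun h => ?_, fun h => ?_,
    lt_top_iff_ne_top.2 fun h => ?_⟩
  · have : (false, false) ∈ (inclLeft 1 ⊓ inclRight 1 : ThreeSumThree) :=
      ⟨(hl _).2 rfl, (hr _).2 rfl⟩
    rw [h] at this
    exact this
  · exact absurd ((hr _).1 (h ((hl (false, true)).2 rfl))) (by decide)
  · exact absurd ((hl _).1 (h ((hr (true, false)).2 rfl))) (by decide)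
  · have : (true, true) ∈ (inclLeft 1 ⊔ inclRight 1 : ThreeSumThree) := by rw [h]; trivial
    rw [LowerSet.mem_sup_iff, hl, hr] at this
    exact absurd this (by decide)

/-! ### The coproduct `𝟑 ⊕ 𝟑` -/

/-- The homomorphism of meet-semilattices sending the coatoms of `Bool × Bool` to `x` and `y`. -/
def boolProdHom {F : Type u} [Order.Frame F] (x y : F) : InfTopHom (Bool × Bool) F where
  toFun p := (bif p.1 then ⊤ else x) ⊓ (bif p.2 then ⊤ else y)
  map_inf' := by
    rintro ⟨_ | _, _ | _⟩ ⟨_ | _, _ | _⟩ <;> simp [inf_comm]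
  map_top' := by simp

/-- A pair of homomorphisms out of `𝟑` is a pair of elements `x`, `y`. It gives a meet-semilattice
homomorphism on `Bool × Bool`, which extends to lower sets by joins; uniqueness holds because the
two copies of `𝟑` generate. -/
theorem isColimit_threeSumThree : Nonempty (Limits.IsColimit
    (Limits.BinaryCofan.mk (Frm.ofHom inclLeft) (Frm.ofHom inclRight))) := by
  let d : ∀ {T : Frm.{0}}, (Frm.of (Fin 3) ⟶ T) → (Frm.of (Fin 3) ⟶ T) →
      (Frm.of ThreeSumThree ⟶ T) := fun {T} f g =>
    Frm.ofHom (lowerSetLift (boolProdHom (f (1 : Fin 3)) (g (1 : Fin 3))))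
  have hl : ∀ {T : Frm.{0}} (f g : Frm.of (Fin 3) ⟶ T), Frm.ofHom inclLeft ≫ d f g = f := by
    intro T f g
    refine Frm.hom_ext (frameHom_chain_ext ?_)
    refine (lowerSetLift_Iic _ (false, true)).trans ?_
    change (bif false then ⊤ else f (1 : Fin 3)) ⊓ (bif true then ⊤ else g (1 : Fin 3)) = _
    simp
  have hr : ∀ {T : Frm.{0}} (f g : Frm.of (Fin 3) ⟶ T), Frm.ofHom inclRight ≫ d f g = g := by
    intro T f g
    refine Frm.hom_ext (frameHom_chain_ext ?_)
    refine (lowerSetLift_Iic _ (true, false)).trans ?_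
    change (bif true then ⊤ else f (1 : Fin 3)) ⊓ (bif false then ⊤ else g (1 : Fin 3)) = _
    simp
  refine ⟨Limits.BinaryCofan.isColimitMk (fun s => d s.inl s.inr) (fun s => hl _ _)
    (fun s => hr _ _) fun s m h₁ h₂ => Frm.hom_ext ?_⟩
  refine FrameHom.eq_of_eqOn_generators threeThree.generates _ _ ?_
  rintro _ (⟨i, rfl⟩ | ⟨i, rfl⟩)
  · exact congrArg (fun k : Frm.of (Fin 3) ⟶ s.pt => k i) (h₁.trans (hl s.inl s.inr).symm)
  · exact congrArg (fun k : Frm.of (Fin 3) ⟶ s.pt => k i) (h₂.trans (hr s.inl s.inr).symm)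

theorem chainHom_injective {F : Type u} [Order.Frame F] {x : F} (h₀ : x ≠ ⊥) (h₁ : x ≠ ⊤) :
    Function.Injective (chainHom x) := by
  have hb : (⊥ : F) ≠ ⊤ := fun h => h₀ (le_bot_iff.1 (h ▸ le_top))
  intro i j h
  change (![⊥, x, ⊤] : Fin 3 → F) i = (![⊥, x, ⊤] : Fin 3 → F) j at h
  fin_cases i <;> fin_cases j <;> simp_all

theorem inclLeft_injective : Function.Injective inclLeft := by
  refine chainHom_injective (fun h => ?_) (fun h => ?_)
  · have : ((false, true) : Bool × Bool) ∈ (⊥ : ThreeSumThree) := h ▸ LowerSet.mem_Iic_iff.2 le_rfl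
    exact this
  · have : ((true, true) : Bool × Bool) ∈ LowerSet.Iic (false, true) := by rw [h]; trivial
    exact absurd (LowerSet.mem_Iic_iff.1 this) (by decide)

theorem inclRight_injective : Function.Injective inclRight := by
  refine chainHom_injective (fun h => ?_) (fun h => ?_)
  · have : ((true, false) : Bool × Bool) ∈ (⊥ : ThreeSumThree) := h ▸ LowerSet.mem_Iic_iff.2 le_rfl
    exact this
  · have : ((true, true) : Bool × Bool) ∈ LowerSet.Iic (true, false) := by rw [h]; trivial
    exact absurd (LowerSet.mem_Iic_iff.1 this) (by decide)

/-! ### Completeness, non-distributivity and the congruence biframe -/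

/-- Arbitrary intersections of rectangles are rectangles; joins are the meets of upper bounds. -/
theorem subPoset_threeThree_complete (A : Set (SubPoset threeThree)) :
    (∃ s, IsLUB A s) ∧ ∃ t, IsGLB A t := by
  have hglb : ∀ A : Set (SubPoset threeThree), ∃ t, IsGLB A t := by
    intro A
    let S : Rectangle := ⟨{p | ∀ R : Rectangle, rectangleSub R ∈ A → p ∈ R.1},
      fun p hp q hq R hR => R.2 p (hp R hR) q (hq R hR)⟩
    refine ⟨rectangleSub S, ?_, ?_⟩
    · intro s hs
      obtain ⟨R, rfl⟩ := rectangleSub.surjective s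
      exact rectangleSub.le_iff_le.2 fun p hp => hp R hs
    · intro s hs
      obtain ⟨R, rfl⟩ := rectangleSub.surjective s
      exact rectangleSub.le_iff_le.2 fun p hp R' hR' => rectangleSub.le_iff_le.1 (hs hR') hp
  obtain ⟨s, hs⟩ := hglb (upperBounds A)
  exact ⟨⟨s, isGLB_upperBounds.1 hs⟩, hglb A⟩

theorem nodeSub_isGLB {p q r : Node} (h : ∀ s : Node, s.points ⊆ r.points ↔
    s.points ⊆ p.points ∧ s.points ⊆ q.points) : IsGLB {nodeSub p, nodeSub q} (nodeSub r) := by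
  rw [isGLB_iff_le_iff, nodeSub.surjective.forall]
  intro s
  simp only [lowerBounds_insert, lowerBounds_singleton, Set.mem_inter_iff, Set.mem_Iic,
    nodeSub_le_iff, h]

theorem nodeSub_isLUB {p q r : Node} (h : ∀ s : Node, r.points ⊆ s.points ↔
    p.points ⊆ s.points ∧ q.points ⊆ s.points) : IsLUB {nodeSub p, nodeSub q} (nodeSub r) := by
  rw [isLUB_iff_le_iff, nodeSub.surjective.forall]
  intro s
  simp only [upperBounds_insert, upperBounds_singleton, Set.mem_inter_iff, Set.mem_Ici,
    nodeSub_le_iff, h]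

/-- The chain is a corner inside a half-square, the side is the opposite corner. The only rectangle
containing two opposite corners is the whole square, so both joins are the top. -/
theorem containsPentagon_threeThree : ContainsPentagon (SubPoset threeThree) := by
  refine ⟨nodeSub .void, nodeSub .c₁c₂, nodeSub .c₁, nodeSub .o₁o₂, nodeSub .whole,
    (nodeSub_lt_iff _ _).2 (by decide), nodeSub_isGLB (by decide), nodeSub_isGLB (by decide),
    nodeSub_isLUB (by decide), nodeSub_isLUB (by decide), ?_⟩
  exact List.Nodup.map (l := [Node.void, .c₁c₂, .c₁, .o₁o₂, .whole]) nodeSub.injective (by simp)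

/-- In a distributive lattice an element is determined by its meet and join with a fixed `y`, which
would identify the two members of the chain. -/
theorem isEmpty_orderIso_distribLattice {P : Type u} [PartialOrder P] (hP : ContainsPentagon P)
    (D : Type v) [DistribLattice D] : IsEmpty (P ≃o D) := by
  constructor
  intro e
  obtain ⟨o, x, z, y, i, hxz, h₁, h₂, h₃, h₄, -⟩ := hP
  have hinf : ∀ {a b c : P}, IsGLB {a, b} c → e a ⊓ e b = e c := fun h => by
    have := (OrderIso.isGLB_image' e).2 h
    rw [Set.image_pair] at this
    exact isGLB_pair.unique this
  have hsup : ∀ {a b c : P}, IsLUB {a, b} c → e a ⊔ e b = e c := fun h => by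
    have := (OrderIso.isLUB_image' e).2 h
    rw [Set.image_pair] at this
    exact isLUB_pair.unique this
  have : e x = e z := eq_of_inf_eq_sup_eq (a := e y) ((hinf h₁).trans (hinf h₂).symm)
    ((hsup h₃).trans (hsup h₄).symm)
  exact hxz.ne (e.injective this)

/-- The generators supply the four half-squares. Since the correspondence reverses order, joins and
meets of congruences are intersections and unions of point sets; each point is an intersection of
two half-squares, and every set is a finite union of points. -/
theorem congruenceAmbient_threeThree : threeThree.congruenceAmbient = Set.univ := by
  have hsub : IsSubframe threeThree.congruenceAmbient := isSubframe_subframeClosure _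
  have hfst : ∀ θ ∈ threeThree.congruenceFst, θ ∈ threeThree.congruenceAmbient := fun θ hθ =>
    subset_subframeClosure _ (Or.inl hθ)
  have hsnd : ∀ θ ∈ threeThree.congruenceSnd, θ ∈ threeThree.congruenceAmbient := fun θ hθ =>
    subset_subframeClosure _ (Or.inr hθ)
  have ho₁ : pointCong {p : Bool × Bool | p.1 = false} ∈ threeThree.congruenceAmbient := by
    rw [← coe_inclLeft_one, ← openCong_eq_pointCong]
    exact hsnd _ (subset_subframeClosure _ (Or.inr ⟨_, ⟨1, rfl⟩, rfl⟩))
  have hc₁ : pointCong {p : Bool × Bool | p.1 = false}ᶜ ∈ threeThree.congruenceAmbient := by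
    rw [← coe_inclLeft_one, ← closedCong_eq_pointCong]
    exact hfst _ (subset_subframeClosure _ (Or.inl ⟨_, ⟨1, rfl⟩, rfl⟩))
  have ho₂ : pointCong {p : Bool × Bool | p.2 = false} ∈ threeThree.congruenceAmbient := by
    rw [← coe_inclRight_one, ← openCong_eq_pointCong]
    exact hfst _ (subset_subframeClosure _ (Or.inr ⟨_, ⟨1, rfl⟩, rfl⟩))
  have hc₂ : pointCong {p : Bool × Bool | p.2 = false}ᶜ ∈ threeThree.congruenceAmbient := by
    rw [← coe_inclRight_one, ← closedCong_eq_pointCong]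
    exact hsnd _ (subset_subframeClosure _ (Or.inl ⟨_, ⟨1, rfl⟩, rfl⟩))
  have hinter : ∀ S T : Set (Bool × Bool), pointCong S ∈ threeThree.congruenceAmbient →
      pointCong T ∈ threeThree.congruenceAmbient →
      pointCong (S ∩ T) ∈ threeThree.congruenceAmbient := by
    intro S T hS hT
    have := hsub.sup_mem hS hT
    have h := OrderIso.map_sup (pointCongIso (P := Bool × Bool)) (OrderDual.toDual S)
      (OrderDual.toDual T)
    exact (congrArg (· ∈ threeThree.congruenceAmbient) h).mpr this
  have hunion : ∀ S T : Set (Bool × Bool), pointCong S ∈ threeThree.congruenceAmbient →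
      pointCong T ∈ threeThree.congruenceAmbient →
      pointCong (S ∪ T) ∈ threeThree.congruenceAmbient := by
    intro S T hS hT
    have := hsub.inf_mem _ hS _ hT
    have h := OrderIso.map_inf (pointCongIso (P := Bool × Bool)) (OrderDual.toDual S)
      (OrderDual.toDual T)
    exact (congrArg (· ∈ threeThree.congruenceAmbient) h).mpr this
  have hempty : pointCong (∅ : Set (Bool × Bool)) ∈ threeThree.congruenceAmbient := by
    have := hinter _ _ ho₁ hc₁
    rwa [Set.inter_compl_self] at this
  have hfstSet : ∀ b, pointCong {p : Bool × Bool | p.1 = b} ∈ threeThree.congruenceAmbient := by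
    rintro (_ | _)
    · exact ho₁
    · convert hc₁ using 2
      ext p
      simp
  have hsndSet : ∀ b, pointCong {p : Bool × Bool | p.2 = b} ∈ threeThree.congruenceAmbient := by
    rintro (_ | _)
    · exact ho₂
    · convert hc₂ using 2
      ext p
      simp
  apply Set.eq_univ_of_forall
  intro θ
  obtain ⟨S, rfl⟩ := (pointCongIso (P := Bool × Bool)).surjective θ
  change pointCong (OrderDual.ofDual S) ∈ _
  induction OrderDual.ofDual S, Set.toFinite (OrderDual.ofDual S) using
    Set.Finite.induction_on with
  | empty => exact hempty
  | @insert q T _ _ ih =>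
    rw [Set.insert_eq]
    refine hunion _ _ ?_ ih
    convert hinter _ _ (hfstSet q.1) (hsndSet q.2) using 2
    ext p
    simp [Prod.ext_iff]

theorem isEmpty_dual_congruenceAmbient :
    IsEmpty (SubPoset threeThree ≃o (threeThree.congruenceAmbient)ᵒᵈ) := by
  constructor
  intro e
  have e₁ : threeThree.congruenceAmbient ≃o FrameCongruence ThreeSumThree :=
    (OrderIso.setCongr _ _ congruenceAmbient_threeThree).trans OrderIso.Set.univ
  -- The order is reversed twice, once by the dual in the claim and once by the passage from
  -- congruences to point sets, so the target is a distributive power set.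
  exact (isEmpty_orderIso_distribLattice containsPentagon_threeThree (Set (Bool × Bool))ᵒᵈᵒᵈ).false
    (e.trans (e₁.trans pointCongIso.symm).dual)

theorem openSub_sup_notMem_range :
    openSub (inclLeft 1 ⊔ inclRight 1 : ThreeSumThree) ∉ Set.range ambientEmbedding := by
  rw [range_ambientEmbedding, ← pointSub_open, LowerSet.coe_sup, coe_inclLeft_one,
    coe_inclRight_one]
  rintro ⟨S, hS, h⟩
  rw [pointSub.injective h] at hS
  -- The L-shaped set contains both off-diagonal corners, so as a rectangle it would contain the
  -- missing corner `(true, true)`.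
  have := hS (true, false) (Or.inr rfl) (false, true) (Or.inl rfl)
  simp at this

theorem mainTheorem9 :
    -- the sublocales of `𝟑 = {0 < a < 1}`: exactly `1, 𝔬(a), 𝔠(a), 0`, forming a diamond
    (∃ Ψ : Bool × Bool ≃o SubPoset (Frm.of (Fin 3)),
      Ψ (true, true) = SubPoset.whole (Frm.of (Fin 3)) ∧
      Ψ (true, false) = openSub (1 : Fin 3) ∧
      Ψ (false, true) = closedSub (1 : Fin 3) ∧
      Ψ (false, false) = voidSub (Fin 3)) ∧
    -- the ambient frame of `𝟑.𝟑` is the coproduct `𝟑 ⊕ 𝟑`, the components are copies of `𝟑`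
    Nonempty (Limits.IsColimit
      (Limits.BinaryCofan.mk (Frm.ofHom inclLeft) (Frm.ofHom inclRight))) ∧
    Function.Injective inclLeft ∧ Function.Injective inclRight ∧
    -- for all `a₁ = a ⊕ 1` and `a₂ = 1 ⊕ a`
    ∀ a₁ a₂ : ThreeSumThree, a₁ = inclLeft 1 → a₂ = inclRight 1 →
    -- the Hasse diagram of `𝟑 ⊕ 𝟑`
    ((∀ x : ThreeSumThree,
        x = ⊥ ∨ x = a₁ ⊓ a₂ ∨ x = a₁ ∨ x = a₂ ∨ x = a₁ ⊔ a₂ ∨ x = ⊤) ∧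
      ⊥ < a₁ ⊓ a₂ ∧ ¬ a₁ ≤ a₂ ∧ ¬ a₂ ≤ a₁ ∧ a₁ ⊔ a₂ < ⊤) ∧
    -- `⟨f⟩ ↦ ⟨f₀⟩` is a well-defined order embedding of `𝒮(𝟑.𝟑)` into `𝒮(𝟑 ⊕ 𝟑)`
    (∃ Θ : SubPoset threeThree ↪o SubPoset (Frm.of ThreeSumThree),
      (∀ Q : ExtremalQuotient threeThree,
        ∃ h : ExtremalEpi (BiFrm.ambientFunctor.map Q.hom),
          Θ (SubPoset.mk Q) = SubPoset.mk ⟨_, BiFrm.ambientFunctor.map Q.hom, h⟩) ∧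
      -- whose image is the sub-meet-semilattice generated by the closed and open sublocales of
      -- `a₁` and `a₂` together with `1` and `0`
      IsLeast {T : Set (SubPoset (Frm.of ThreeSumThree)) |
        {openSub a₁, openSub a₂, closedSub a₁, closedSub a₂,
          SubPoset.whole (Frm.of ThreeSumThree), voidSub ThreeSumThree} ⊆ T ∧
        ∀ s ∈ T, ∀ t ∈ T, ∀ m, IsGLB {s, t} m → m ∈ T} (Set.range Θ) ∧
      -- the Hasse diagram of `𝒮(𝟑.𝟑)`
      (∃ Φ : Node ≃ SubPoset threeThree,
        (∀ p q, Φ p ≤ Φ q ↔ Relation.ReflTransGen Edge p q) ∧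
        (∀ p q, Φ p ⋖ Φ q ↔ Edge p q) ∧
        Θ (Φ .whole) = SubPoset.whole (Frm.of ThreeSumThree) ∧
        Θ (Φ .c₁) = closedSub a₁ ∧
        Θ (Φ .c₂) = closedSub a₂ ∧
        Θ (Φ .o₂) = openSub a₂ ∧
        Θ (Φ .o₁) = openSub a₁ ∧
        Θ (Φ .c₁c₂) = closedSub (a₁ ⊔ a₂) ∧
        IsGLB {closedSub a₁, openSub a₂} (Θ (Φ .c₁o₂)) ∧
        IsGLB {closedSub a₂, openSub a₁} (Θ (Φ .c₂o₁)) ∧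
        Θ (Φ .o₁o₂) = openSub (a₁ ⊓ a₂) ∧
        Θ (Φ .void) = voidSub ThreeSumThree) ∧
      -- `𝔬(a₁ ∨ a₂)` is represented in the ambient frame of the congruence biframe, but it has no
      -- counterpart in `𝒮(𝟑.𝟑)`
      FrameCongruence.openCong (a₁ ⊔ a₂) ∈ threeThree.congruenceAmbient ∧
      openSub (a₁ ⊔ a₂) ∉ Set.range Θ) ∧
    -- `𝒮(𝟑.𝟑)` is a complete lattice containing a copy of `N₅`; it is not distributive, hence
    -- not a coframe
    (∀ A : Set (SubPoset threeThree), (∃ s, IsLUB A s) ∧ ∃ t, IsGLB A t) ∧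
    ContainsPentagon (SubPoset threeThree) ∧
    (∀ (D : Type u) [DistribLattice D], IsEmpty (SubPoset threeThree ≃o D)) ∧
    (∀ (D : Type v) [Order.Coframe D], IsEmpty (SubPoset threeThree ≃o D)) ∧
    -- `𝒮(𝟑.𝟑)` is not dually isomorphic to the ambient frame of the congruence biframe
    IsEmpty (SubPoset threeThree ≃o (threeThree.congruenceAmbient)ᵒᵈ) := by
  refine ⟨exists_chain_subPoset_iso, isColimit_threeSumThree, inclLeft_injective,
    inclRight_injective, ?_⟩
  rintro a₁ a₂ rfl rfl
  refine ⟨⟨hasse_sum, hasse_sum_order⟩,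
    ⟨ambientEmbedding, fun Q => ⟨extremalEpi_ambient Q, ambientEmbedding_mk Q⟩,
      isLeast_range_ambientEmbedding,
      ⟨nodeSub, fun p q => (nodeSub_le_iff p q).trans (reflTransGen_edge_iff p q).symm,
        nodeSub_covBy_iff, ?_⟩,
      congruenceAmbient_threeThree ▸ Set.mem_univ _, openSub_sup_notMem_range⟩,
    subPoset_threeThree_complete, containsPentagon_threeThree,
    fun D _ => isEmpty_orderIso_distribLattice containsPentagon_threeThree D,
    fun D _ => isEmpty_orderIso_distribLattice containsPentagon_threeThree D,
    isEmpty_dual_congruenceAmbient⟩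
  simp only [ambientEmbedding_nodeSub, ← pointSub_open, ← pointSub_closed, ← pointSub_univ,
    ← pointSub_empty, LowerSet.coe_sup, LowerSet.coe_inf, coe_inclLeft_one, coe_inclRight_one]
  have hglb : ∀ S T R : Set (Bool × Bool), R = S ∩ T →
      IsGLB {pointSub S, pointSub T} (pointSub R) := by
    rintro S T _ rfl
    exact pointSub_isGLB S T
  refine ⟨?_, ?_, ?_, ?_, ?_, ?_, hglb _ _ _ ?_, hglb _ _ _ ?_, ?_, ?_⟩ <;>
    first
    | ext p; simp [Node.points, Prod.ext_iff, and_comm]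
    | congr 1; ext p; simp [Node.points, Prod.ext_iff]
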